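/- Let $M$ be a (Hausdorff) smooth manifold without boundary, modelled on a finite-dimensional real vector space, and let $h\ge 0$ be an integer. The stable big tangent bundle of index $h$ is $\mathbf T_h^{big}M=(TM\times\mathbb R^h)\oplus(T^*M\times\mathbb R^h)$, with the neutral metric $$G((X_1,u_1)\oplus(\alpha_1,v_1),(X_2,u_2)\oplus(\alpha_2,v_2))=\tfrac12(\alpha_2(X_1)+\alpha_1(X_2)+u_1\cdot v_2+u_2\cdot v_1);$$ for $h=0$ it is the big tangent bundle $T^{big}M=TM\oplus T^*M$. A stable almost Dirac structure of index $h$ on $M$ is a smooth subbundle $L\subseteq\mathbf T_h^{big}M$ each of whose fibres is a maximal $G$-isotropic subspace; an almost Dirac structure on a manifold $N$ is a smooth, fibrewise maximal isotropic subbundle of $T^{big}N$. On sections of $T^{big}N$, the Courant bracket twisted by a closed $3$-form $\Theta$ is $$[X\oplus\alpha,Y\oplus\beta]_\Theta=[X,Y]\oplus\bigl(L_X\beta-L_Y\alpha-\tfrac12 d(\beta(X)-\alpha(Y))+\Theta(X,Y,\cdot)\bigr).$$ Let $\Phi$ be a closed $3$-form and $\Psi=(\Psi^1,\dots,\Psi^h)$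 closed $2$-forms on $M$. The stable Courant bracket of index $h$ twisted by $(\Phi,\Psi)$ of two sections $(X_i,u_i)\oplus(\alpha_i,v_i)$ of $\mathbf T_h^{big}M$ is $$([X_1,X_2],\,X_1u_2-X_2u_1)\oplus\Bigl(L_{X_1}\alpha_2-L_{X_2}\alpha_1+\tfrac12 d(\alpha_1(X_2)-\alpha_2(X_1))+\Phi(X_1,X_2,\cdot)+u_1\cdot\Psi(X_2,\cdot)-u_2\cdot\Psi(X_1,\cdot)$$ $$+\tfrac12(u_2\cdot dv_1+v_2\cdot du_1-u_1\cdot dv_2-v_1\cdot du_2),\;X_1v_2-X_2v_1+\Psi(X_1,X_2)\Bigr).$$ A stable almost Dirac structure $L$ (respectively an almost Dirac structure $D$) is integrable for a bracket if its space of global smooth sections is closed under that bracket. Identify $\mathbf T^{big}_{h}M$ at $x$ with $T^{big}(M\times\mathbb R^h)$ at $(x,t)$, for every $t\in\mathbb R^h$, by $$(X,u)\oplus(\alpha,v)\leftrightarrow\Bigl(X+\sum_a u^a\tfrac{\partial}{\partial t^a}\Bigr)\oplus\Bigl(\alpha+\sum_a v_a\,dt^a\Bigr),\qquad(*)$$ and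 for a family $L=(L_x)$ of fibrewise subspaces let $\tilde L_{(x,t)}$ be the image of $L_x$ under $(*)$. An almost Dirac structure $D$ on $M\times\mathbb R^h$ is translation invariant if $D_{(x,t+s)}=(\tau_s)_*D_{(x,t)}$ for all $s,t\in\mathbb R^h$, $x\in M$, where $\tau_s(x,t)=(x,t+s)$. **Proposition.** 1. For all closed $\Phi,\Psi^a$ as above, $(*)$ carries the stable Courant bracket twisted by $(\Phi,\Psi)$ of two smooth sections of $\mathbf T_h^{big}M$ to the Courant bracket on $M\times\mathbb R^h$, twisted by $\Phi+\sum_a dt^a\wedge\Psi^a$, of the corresponding translation invariant sections. 2. $L\mapsto\tilde L$ is a bijection from the stable almost Dirac structures of index $h$ on $M$ onto the translation invariant almost Dirac structures on $M\times\mathbb R^h$; its inverse is the restriction $D\mapsto D|_{t=0}$ (read through $(*)$ at $t=0$). 3. For all closed $\Phi,\Psi^a$ as above and every stable almost Dirac structure $L$ of index $h$ on $M$, $L$ is integrable for the stable Courant bracket twisted by $(\Phi,\Psi)$ if and only if $\tilde L$ is integrable for the Courant bracket on $M\times\mathbb R^h$ twisted by $\Phi+\sum_a dt^a\wedge\Psi^a$.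 -/

import Mathlib

open scoped Manifold ContDiff Bundle

noncomputable section

namespace StableDirac

/-! ### Linear algebra -/

/-- The exterior product `ℓ ∧ η` of a covector and a `2`-covector, with the normalization
`(ℓ ∧ η)(v₀, v₁, v₂) = ℓ(v₀) η(v₁, v₂) - ℓ(v₁) η(v₀, v₂) + ℓ(v₂) η(v₀, v₁)`. -/
def wedge {V : Type*} [AddCommGroup V] [Module ℝ V] [TopologicalSpace V]
    (l : V →L[ℝ] ℝ) (η : V [⋀^Fin 2]→L[ℝ] ℝ) : V [⋀^Fin 3]→L[ℝ] ℝ :=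
  { AlternatingMap.alternatizeUncurryFin
      ((l : V →ₗ[ℝ] ℝ).smulRight η.toAlternatingMap) with
    cont := by
      have h : ∀ v : Fin 3 → V,
          AlternatingMap.alternatizeUncurryFin
            ((l : V →ₗ[ℝ] ℝ).smulRight η.toAlternatingMap) v
            = ∑ i : Fin 3, (-1 : ℤ) ^ (i : ℕ) • (l (v i) * η (i.removeNth v)) := by
        intro v
        simp [AlternatingMap.alternatizeUncurryFin_apply]
      change Continuous fun v : Fin 3 → V =>
          AlternatingMap.alternatizeUncurryFin
            ((l : V →ₗ[ℝ] ℝ).smulRight η.toAlternatingMap) v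
      simp only [h]
      refine continuous_finsetSum _ fun i _ => Continuous.zsmul ?_ _
      refine (l.continuous.comp (continuous_apply i)).mul (η.cont.comp ?_)
      exact continuous_pi fun j => continuous_apply _ }

theorem wedge_apply {V : Type*} [AddCommGroup V] [Module ℝ V] [TopologicalSpace V]
    (l : V →L[ℝ] ℝ) (η : V [⋀^Fin 2]→L[ℝ] ℝ) (a b c : V) :
    wedge l η ![a, b, c] = l a * η ![b, c] - l b * η ![a, c] + l c * η ![a, b] := by
  have h : wedge l η ![a, b, c]
      = AlternatingMap.alternatizeUncurryFin
            ((l : V →ₗ[ℝ] ℝ).smulRight η.toAlternatingMap) ![a, b, c] := rfl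
  have h0 : (0 : Fin 3).removeNth ![a, b, c] = ![b, c] := by
    ext i; fin_cases i <;> rfl
  have h1 : (1 : Fin 3).removeNth ![a, b, c] = ![a, c] := by
    ext i; fin_cases i <;> rfl
  have h2 : (2 : Fin 3).removeNth ![a, b, c] = ![a, b] := by
    ext i; fin_cases i <;> rfl
  rw [h, AlternatingMap.alternatizeUncurryFin_apply]
  simp [Fin.sum_univ_three, h0, h1, h2]
  ring

/-- `i(X) η = η(X, ·)` for a `2`-covector `η`. -/
def contract₂ {V : Type*} [AddCommGroup V] [Module ℝ V] [TopologicalSpace V]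
    (η : V [⋀^Fin 2]→L[ℝ] ℝ) (X : V) : V →L[ℝ] ℝ :=
  η.toContinuousMultilinearMap.toContinuousLinearMap ![X, 0] 1

/-- `i(X ∧ Y) η = η(X, Y, ·)` for a `3`-covector `η`. -/
def contract₃ {V : Type*} [AddCommGroup V] [Module ℝ V] [TopologicalSpace V]
    (η : V [⋀^Fin 3]→L[ℝ] ℝ) (X Y : V) : V →L[ℝ] ℝ :=
  η.toContinuousMultilinearMap.toContinuousLinearMap ![X, Y, 0] 2

theorem contract₂_apply {V : Type*} [AddCommGroup V] [Module ℝ V] [TopologicalSpace V]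
    (η : V [⋀^Fin 2]→L[ℝ] ℝ) (X Z : V) : contract₂ η X Z = η ![X, Z] := by
  have h : Function.update ![X, 0] 1 Z = ![X, Z] := by
    ext i; fin_cases i <;> rfl
  change η (Function.update ![X, 0] 1 Z) = _
  rw [h]

theorem contract₃_apply {V : Type*} [AddCommGroup V] [Module ℝ V] [TopologicalSpace V]
    (η : V [⋀^Fin 3]→L[ℝ] ℝ) (X Y Z : V) : contract₃ η X Y Z = η ![X, Y, Z] := by
  have h : Function.update ![X, Y, 0] 2 Z = ![X, Y, Z] := by
    ext i; fin_cases i <;> rfl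
  change η (Function.update ![X, Y, 0] 2 Z) = _
  rw [h]

/-- A subspace is maximal isotropic for `G` if it is isotropic and contained in no larger
isotropic subspace. -/
def IsMaximalIsotropic {V : Type*} [AddCommGroup V] [Module ℝ V] (G : V → V → ℝ)
    (W : Submodule ℝ V) : Prop :=
  Maximal (fun W : Submodule ℝ V => ∀ a ∈ W, ∀ b ∈ W, G a b = 0) W

/-- A family of subspaces `L p` of the fibres `V p` of a vector bundle over `N` is a smooth
subbundle if around every point it has a local frame of smooth sections; `smoothOn U e` says that
the section `e` of the ambient bundle is smooth on `U`. -/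
def IsSmoothSubbundle {N : Type*} [TopologicalSpace N] {V : N → Type*}
    [∀ p, AddCommGroup (V p)] [∀ p, Module ℝ (V p)]
    (smoothOn : Set N → (Π p, V p) → Prop) (L : Π p, Submodule ℝ (V p)) : Prop :=
  ∀ p₀ : N, ∃ U : Set N, IsOpen U ∧ p₀ ∈ U ∧ ∃ (r : ℕ) (e : Fin r → Π p, V p),
    (∀ i, smoothOn U (e i)) ∧
    ∀ p ∈ U, LinearIndependent ℝ (fun i => e i p) ∧
      Submodule.span ℝ (Set.range fun i => e i p) = L p

/-! ### Calculus on a manifold -/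

section Manifold

variable {E : Type*} [NormedAddCommGroup E] [NormedSpace ℝ E]
  {H : Type*} [TopologicalSpace H] (I : ModelWithCorners ℝ E H)
  {M : Type*} [TopologicalSpace M] [ChartedSpace H M]

/-- The expression of the `k`-form `η` in the preferred chart at `x₀`, i.e. its pullback by the
inverse of the chart. -/
def formInChart {k : ℕ} (η : Π x : M, TangentSpace I x [⋀^Fin k]→L[ℝ] ℝ) (x₀ : M) :
    E → E [⋀^Fin k]→L[ℝ] ℝ := fun y =>
  (η ((extChartAt I x₀).symm y)).compContinuousLinearMap
    (mfderivWithin 𝓘(ℝ, E) I (extChartAt I x₀).symm (Set.range I) y)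

/-- A `k`-form is smooth if it is so in charts. -/
def IsSmoothForm {k : ℕ} (η : Π x : M, TangentSpace I x [⋀^Fin k]→L[ℝ] ℝ) : Prop :=
  ∀ x₀ : M, ContDiffOn ℝ ∞ (formInChart I η x₀) (extChartAt I x₀).target

/-- The exterior derivative of a `k`-form, computed at `x` in the preferred chart at `x`. -/
def mextDeriv {k : ℕ} (η : Π x : M, TangentSpace I x [⋀^Fin k]→L[ℝ] ℝ) (x : M) :
    TangentSpace I x [⋀^Fin (k + 1)]→L[ℝ] ℝ :=
  (extDerivWithin (formInChart I η x) (Set.range I) (extChartAt I x x)).compContinuousLinearMap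
    (mvfderiv I (extChartAt I x) x)

/-- Smooth closed `k`-forms. -/
def IsClosedForm {k : ℕ} (η : Π x : M, TangentSpace I x [⋀^Fin k]→L[ℝ] ℝ) : Prop :=
  IsSmoothForm I η ∧ ∀ x, mextDeriv I η x = 0

/-- The expression of a vector field in the preferred chart at `x₀`. -/
def vectorInChart (X : Π x : M, TangentSpace I x) (x₀ : M) : E → E :=
  VectorField.mpullbackWithin 𝓘(ℝ, E) I (extChartAt I x₀).symm X (Set.range I)

/-- The expression of a field of covectors in the preferred chart at `x₀`. -/
def covectorInChart (α : Π x : M, TangentSpace I x →L[ℝ] ℝ) (x₀ : M) : E → E →L[ℝ] ℝ := fun y =>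
  (α ((extChartAt I x₀).symm y)).comp
    (mfderivWithin 𝓘(ℝ, E) I (extChartAt I x₀).symm (Set.range I) y)

/-- The Lie derivative `L_X α` of a `1`-form, computed at `x` in the preferred chart at `x` by
`(L_X α)_j = ∑ i, (X^i ∂_i α_j + α_i ∂_j X^i)`. -/
def lieDerivative (X : Π x : M, TangentSpace I x) (α : Π x : M, TangentSpace I x →L[ℝ] ℝ)
    (x : M) : TangentSpace I x →L[ℝ] ℝ :=
  (fderivWithin ℝ (covectorInChart I α x) (Set.range I) (extChartAt I x x)
      (vectorInChart I X x (extChartAt I x x))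
    + (covectorInChart I α x (extChartAt I x x)).comp
      (fderivWithin ℝ (vectorInChart I X x) (Set.range I) (extChartAt I x x))).comp
    (mvfderiv I (extChartAt I x) x)

/-- Smoothness of a vector field on a set. -/
def SmoothVectorOn [IsManifold I ∞ M] (U : Set M) (X : Π x : M, TangentSpace I x) : Prop :=
  ContMDiffOn I I.tangent ∞ (fun x => (⟨x, X x⟩ : TangentBundle I M)) U

/-- Smoothness of a `1`-form on a set, as a section of the cotangent bundle. -/
def SmoothCovectorOn [IsManifold I ∞ M] (U : Set M) (α : Π x : M, TangentSpace I x →L[ℝ] ℝ) :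
    Prop :=
  ContMDiffOn I (I.prod 𝓘(ℝ, E →L[ℝ] ℝ)) ∞
    (fun x => (⟨x, α x⟩ : Bundle.TotalSpace (E →L[ℝ] ℝ)
      (fun x : M => TangentSpace I x →L[ℝ] Bundle.Trivial M ℝ x))) U

/-! ### The big tangent bundle and Dirac structures -/

/-- The fibre at `x` of the big tangent bundle `TM ⊕ T*M`. -/
abbrev BigTangent (x : M) : Type _ := TangentSpace I x × (TangentSpace I x →L[ℝ] ℝ)

/-- The neutral metric on the big tangent bundle. -/
def bigMetric (x : M) (a b : BigTangent I x) : ℝ :=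
  (1 / 2) * (b.2 a.1 + a.2 b.1)

/-- The nondegenerate `2`-form on the big tangent bundle. -/
def bigOmega (x : M) (a b : BigTangent I x) : ℝ :=
  (1 / 2) * (b.2 a.1 - a.2 b.1)

/-- Smoothness on `U` of a section of the big tangent bundle. -/
def SmoothBigSectionOn [IsManifold I ∞ M] (U : Set M) (s : Π x : M, BigTangent I x) : Prop :=
  SmoothVectorOn I U (fun x => (s x).1) ∧ SmoothCovectorOn I U (fun x => (s x).2)

/-- The Courant bracket twisted by the `3`-form `Θ`:
`[X ⊕ α, Y ⊕ β] = [X, Y] ⊕ (L_X β - L_Y α - d(Ω(X ⊕ α, Y ⊕ β)) + i(X ∧ Y) Θ)`. -/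
def courantBracket (Θ : Π x : M, TangentSpace I x [⋀^Fin 3]→L[ℝ] ℝ)
    (s₁ s₂ : Π x : M, BigTangent I x) (x : M) : BigTangent I x :=
  (VectorField.mlieBracket I (fun y => (s₁ y).1) (fun y => (s₂ y).1) x,
    lieDerivative I (fun y => (s₁ y).1) (fun y => (s₂ y).2) x
    - lieDerivative I (fun y => (s₂ y).1) (fun y => (s₁ y).2) x
    - mvfderiv I (fun y => bigOmega I y (s₁ y) (s₂ y)) x
    + contract₃ (Θ x) (s₁ x).1 (s₂ x).1)

/-- Almost Dirac structures: maximal isotropic smooth subbundles of the big tangent bundle. -/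
structure IsAlmostDirac [IsManifold I ∞ M] (D : Π x : M, Submodule ℝ (BigTangent I x)) :
    Prop where
  smooth : IsSmoothSubbundle (SmoothBigSectionOn I) D
  maximal_isotropic : ∀ x, IsMaximalIsotropic (bigMetric I x) (D x)

/-- Integrability: the space of global smooth sections is closed under the Courant bracket. -/
def IsIntegrable [IsManifold I ∞ M] (Θ : Π x : M, TangentSpace I x [⋀^Fin 3]→L[ℝ] ℝ)
    (D : Π x : M, Submodule ℝ (BigTangent I x)) : Prop :=
  ∀ s₁ s₂ : Π x : M, BigTangent I x,
    SmoothBigSectionOn I Set.univ s₁ → SmoothBigSectionOn I Set.univ s₂ →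
    (∀ x, s₁ x ∈ D x) → (∀ x, s₂ x ∈ D x) → ∀ x, courantBracket I Θ s₁ s₂ x ∈ D x

/-! ### The stable big tangent bundle and stable Dirac structures -/

/-- The fibre at `x` of the stable big tangent bundle `(TM × ℝ^h) ⊕ (T*M × ℝ^h)` of index `h`. -/
abbrev StableBigTangent (h : ℕ) (x : M) : Type _ :=
  (TangentSpace I x × EuclideanSpace ℝ (Fin h)) ×
    ((TangentSpace I x →L[ℝ] ℝ) × EuclideanSpace ℝ (Fin h))

/-- The neutral metric on the stable big tangent bundle. -/
def stableMetric (h : ℕ) (x : M) (a b : StableBigTangent I h x) : ℝ :=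
  (1 / 2) * (b.2.1 a.1.1 + a.2.1 b.1.1 + inner ℝ a.1.2 b.2.2 + inner ℝ b.1.2 a.2.2)

/-- Smoothness on `U` of a section of the stable big tangent bundle. -/
def SmoothStableSectionOn [IsManifold I ∞ M] (h : ℕ) (U : Set M)
    (s : Π x : M, StableBigTangent I h x) : Prop :=
  SmoothVectorOn I U (fun x => (s x).1.1) ∧
  ContMDiffOn I 𝓘(ℝ, EuclideanSpace ℝ (Fin h)) ∞ (fun x => (s x).1.2) U ∧
  SmoothCovectorOn I U (fun x => (s x).2.1) ∧
  ContMDiffOn I 𝓘(ℝ, EuclideanSpace ℝ (Fin h)) ∞ (fun x => (s x).2.2) U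

/-- The stable Courant bracket of index `h` twisted by `Φ` and `Ψ = (Ψ^1, …, Ψ^h)`: the bracket of
`(X₁, u₁) ⊕ (α₁, v₁)` and `(X₂, u₂) ⊕ (α₂, v₂)` is `(X, u) ⊕ (α, v)` with
* `X = [X₁, X₂]`, `u = X₁ u₂ - X₂ u₁`,
* `α = L_{X₁} α₂ - L_{X₂} α₁ + ½ d(α₁(X₂) - α₂(X₁)) + i(X₁ ∧ X₂) Φ`
  `+ u₁ · i(X₂) Ψ - u₂ · i(X₁) Ψ + ½ (u₂ · dv₁ + v₂ · du₁ - u₁ · dv₂ - v₁ · du₂)`,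
* `v = X₁ v₂ - X₂ v₁ + Ψ(X₁, X₂)`. -/
def stableBracket {h : ℕ} (Φ : Π x : M, TangentSpace I x [⋀^Fin 3]→L[ℝ] ℝ)
    (Ψ : Fin h → Π x : M, TangentSpace I x [⋀^Fin 2]→L[ℝ] ℝ)
    (s₁ s₂ : Π x : M, StableBigTangent I h x) (x : M) : StableBigTangent I h x :=
  let X₁ : Π y : M, TangentSpace I y := fun y => (s₁ y).1.1
  let X₂ : Π y : M, TangentSpace I y := fun y => (s₂ y).1.1
  let u₁ : M → EuclideanSpace ℝ (Fin h) := fun y => (s₁ y).1.2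
  let u₂ : M → EuclideanSpace ℝ (Fin h) := fun y => (s₂ y).1.2
  let α₁ : Π y : M, TangentSpace I y →L[ℝ] ℝ := fun y => (s₁ y).2.1
  let α₂ : Π y : M, TangentSpace I y →L[ℝ] ℝ := fun y => (s₂ y).2.1
  let v₁ : M → EuclideanSpace ℝ (Fin h) := fun y => (s₁ y).2.2
  let v₂ : M → EuclideanSpace ℝ (Fin h) := fun y => (s₂ y).2.2
  ((VectorField.mlieBracket I X₁ X₂ x,
      mvfderiv I u₂ x (X₁ x) - mvfderiv I u₁ x (X₂ x)),
    (lieDerivative I X₁ α₂ x - lieDerivative I X₂ α₁ x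
      + (1 / 2 : ℝ) • mvfderiv I (fun y => α₁ y (X₂ y) - α₂ y (X₁ y)) x
      + contract₃ (Φ x) (X₁ x) (X₂ x)
      + ∑ a, u₁ x a • contract₂ (Ψ a x) (X₂ x)
      - ∑ a, u₂ x a • contract₂ (Ψ a x) (X₁ x)
      + (1 / 2 : ℝ) • ((innerSL ℝ (u₂ x)).comp (mvfderiv I v₁ x)
        + (innerSL ℝ (v₂ x)).comp (mvfderiv I u₁ x)
        - (innerSL ℝ (u₁ x)).comp (mvfderiv I v₂ x)
        - (innerSL ℝ (v₁ x)).comp (mvfderiv I u₂ x)),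
      mvfderiv I v₂ x (X₁ x) - mvfderiv I v₁ x (X₂ x)
        + WithLp.toLp 2 (fun a => Ψ a x ![X₁ x, X₂ x])))

/-- Stable almost Dirac structures of index `h`: maximal isotropic smooth subbundles of the stable
big tangent bundle. -/
structure IsStableAlmostDirac [IsManifold I ∞ M] (h : ℕ)
    (L : Π x : M, Submodule ℝ (StableBigTangent I h x)) : Prop where
  smooth : IsSmoothSubbundle (SmoothStableSectionOn I h) L
  maximal_isotropic : ∀ x, IsMaximalIsotropic (stableMetric I h x) (L x)

/-- Integrability: the space of global smooth sections is closed under the stable Courant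
bracket. -/
def IsStableIntegrable [IsManifold I ∞ M] {h : ℕ}
    (Φ : Π x : M, TangentSpace I x [⋀^Fin 3]→L[ℝ] ℝ)
    (Ψ : Fin h → Π x : M, TangentSpace I x [⋀^Fin 2]→L[ℝ] ℝ)
    (L : Π x : M, Submodule ℝ (StableBigTangent I h x)) : Prop :=
  ∀ s₁ s₂ : Π x : M, StableBigTangent I h x,
    SmoothStableSectionOn I h Set.univ s₁ → SmoothStableSectionOn I h Set.univ s₂ →
    (∀ x, s₁ x ∈ L x) → (∀ x, s₂ x ∈ L x) → ∀ x, stableBracket I Φ Ψ s₁ s₂ x ∈ L x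

/-! ### The manifold `M × ℝ^h` -/

/-- The model of `M × ℝ^h`. -/
abbrev prodModel (h : ℕ) :
    ModelWithCorners ℝ (E × EuclideanSpace ℝ (Fin h))
      (ModelProd H (EuclideanSpace ℝ (Fin h))) :=
  I.prod 𝓘(ℝ, EuclideanSpace ℝ (Fin h))

/-- The translation `τ_s (x, t) = (x, t + s)` of `M × ℝ^h`. -/
def translation {h : ℕ} (s : EuclideanSpace ℝ (Fin h)) (p : M × EuclideanSpace ℝ (Fin h)) :
    M × EuclideanSpace ℝ (Fin h) :=
  (p.1, p.2 + s)

/-- Translation invariance: for all `s` and `p`, the fibre over `τ_s p` is the image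
`(τ_s)_* (D p)` of the fibre over `p`; here `(τ_s)_* (X ⊕ α)` is the `Y ⊕ β` with
`Y = dτ_s X` and `β ∘ dτ_s = α`. -/
def IsTranslationInvariant {h : ℕ}
    (D : Π p : M × EuclideanSpace ℝ (Fin h), Submodule ℝ (BigTangent (prodModel I h) p)) : Prop :=
  ∀ (s : EuclideanSpace ℝ (Fin h)) (p : M × EuclideanSpace ℝ (Fin h))
    (b : BigTangent (prodModel I h) (translation s p)),
    b ∈ D (translation s p) ↔
      ∃ a ∈ D p, mfderiv (prodModel I h) (prodModel I h) (translation s) p a.1 = b.1 ∧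
        b.2.comp (mfderiv (prodModel I h) (prodModel I h) (translation s) p) = a.2

/-- The identification, at the point `p = (x, t)`,
`(X, u) ⊕ (α, v) ↦ (X + ∑ a, u^a ∂/∂t^a) ⊕ (α + ∑ a, v_a dt^a)`. -/
def liftAt {h : ℕ} (p : M × EuclideanSpace ℝ (Fin h)) :
    StableBigTangent I h p.1 →ₗ[ℝ] BigTangent (prodModel I h) p where
  toFun a := (((a.1.1, a.1.2) : E × EuclideanSpace ℝ (Fin h)),
    a.2.1.comp (mfderiv (prodModel I h) I Prod.fst p)
      + (innerSL ℝ a.2.2).comp (mvfderiv (prodModel I h) Prod.snd p))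
  map_add' a b := by
    refine Prod.ext rfl (ContinuousLinearMap.ext fun w => ?_)
    change (a.2.1 (mfderiv (prodModel I h) I Prod.fst p w)
        + b.2.1 (mfderiv (prodModel I h) I Prod.fst p w))
        + inner ℝ (a.2.2 + b.2.2) (mvfderiv (prodModel I h) Prod.snd p w)
      = (a.2.1 (mfderiv (prodModel I h) I Prod.fst p w)
          + inner ℝ a.2.2 (mvfderiv (prodModel I h) Prod.snd p w))
        + (b.2.1 (mfderiv (prodModel I h) I Prod.fst p w)
          + inner ℝ b.2.2 (mvfderiv (prodModel I h) Prod.snd p w))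
    rw [inner_add_left]
    ring
  map_smul' c a := by
    refine Prod.ext rfl (ContinuousLinearMap.ext fun w => ?_)
    change c * a.2.1 (mfderiv (prodModel I h) I Prod.fst p w)
        + inner ℝ (c • a.2.2) (mvfderiv (prodModel I h) Prod.snd p w)
      = c * (a.2.1 (mfderiv (prodModel I h) I Prod.fst p w)
          + inner ℝ a.2.2 (mvfderiv (prodModel I h) Prod.snd p w))
    rw [real_inner_smul_left]
    ring

/-- The translation invariant section of `T^big (M × ℝ^h)` defined by a section of the stable big
tangent bundle. -/
def liftSection {h : ℕ} (s : Π x : M, StableBigTangent I h x)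
    (p : M × EuclideanSpace ℝ (Fin h)) : BigTangent (prodModel I h) p :=
  liftAt I p (s p.1)

/-- The family `L̃` on `M × ℝ^h` produced by `L`: the fibre over `(x, t)` is `L x`, placed in
`T^big (M × ℝ^h)` over `(x, t)`. -/
def extend {h : ℕ} (L : Π x : M, Submodule ℝ (StableBigTangent I h x))
    (p : M × EuclideanSpace ℝ (Fin h)) : Submodule ℝ (BigTangent (prodModel I h) p) :=
  (L p.1).map (liftAt I p)

/-- The restriction to `t = 0` of a family on `M × ℝ^h`, seen in the stable big tangent bundle. -/
def restrictZero {h : ℕ}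
    (D : Π p : M × EuclideanSpace ℝ (Fin h), Submodule ℝ (BigTangent (prodModel I h) p)) (x : M) :
    Submodule ℝ (StableBigTangent I h x) :=
  (D (x, 0)).comap (liftAt I (x, 0))

/-- The twist form `Φ + ∑ a, dt^a ∧ Ψ^a` on `M × ℝ^h`. -/
def twistForm {h : ℕ} (Φ : Π x : M, TangentSpace I x [⋀^Fin 3]→L[ℝ] ℝ)
    (Ψ : Fin h → Π x : M, TangentSpace I x [⋀^Fin 2]→L[ℝ] ℝ)
    (p : M × EuclideanSpace ℝ (Fin h)) :
    TangentSpace (prodModel I h) p [⋀^Fin 3]→L[ℝ] ℝ :=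
  (Φ p.1).compContinuousLinearMap (mfderiv (prodModel I h) I Prod.fst p)
    + ∑ a, wedge
        (mvfderiv (prodModel I h) (fun q : M × EuclideanSpace ℝ (Fin h) => q.2 a) p)
        ((Ψ a p.1).compContinuousLinearMap (mfderiv (prodModel I h) I Prod.fst p))

end Manifold

end StableDirac

end

open StableDirac

/-! A translation invariant section of the big tangent bundle of `M × ℝ^h` has coefficients that do
not depend on `t`. In a product chart every derivative of such a section is therefore a derivative
along `M`. Expanding the Courant bracket of two lifted sections then gives the stable bracket term
by term (`courantBracket_lift`): the Lie derivatives contribute `v · du`, the exact term contributes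
half of `d(u · v)`, and `dt^a ∧ Ψ^a` contributes the terms in `Ψ`.

The bijection is formal once `(*)` is known to be a fibrewise isometric isomorphism that preserves
smoothness in both directions. Translations have identity differential in the model, so an invariant
family is determined by its fibres over `t = 0`.

In the equivalence of integrability, passing from `L̃` to `L` only tests invariant sections. The
converse is the substantial direction, because a section of `L̃` may depend on `t`. It rests on
three facts.

`bigMetric_courantBracket_rotate`: for three sections that are pairwise orthogonal everywhere,
`G([s₁, s₂], s₃)` is invariant under cyclic rotation. Its dependence on `s₃` is visibly pointwise,
so after rotation its dependence on each of the three sections is pointwise within sections of `L̃`.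
This plays the role of the usual tensoriality argument and avoids Leibniz rules for the bracket.

`exists_smooth_section_eq`: each vector of `L` is the value of a global section of `L`, by cutting
off a local frame with a bump function. Each argument can thus be replaced by an invariant lift with
the same value at the point, and integrability of `L` makes the pairing vanish.

`IsMaximalIsotropic.mem_of_neutralForm_eq_zero`: a maximal isotropic subspace of `E ⊕ E*` contains
its orthogonal, so a bracket orthogonal to `L̃` lies in `L̃`. Maximality means maximality under
inclusion, so this needs the neutral signature. -/

namespace StableDirac

section Chart

variable {E : Type*} [NormedAddCommGroup E] [NormedSpace ℝ E]
  {H : Type*} [TopologicalSpace H] (I : ModelWithCorners ℝ E H)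
  {M : Type*} [TopologicalSpace M] [ChartedSpace H M]

/-! ### Fields in charts

Vector fields and fields of covectors are regarded here as functions with values in the model space
and in its dual. -/

/-- The derivative of the inverse of the preferred chart at `x₀`, as an endomorphism of the model
space. -/
noncomputable def chartFrame (x₀ : M) (y : E) : E →L[ℝ] E :=
  mfderivWithin 𝓘(ℝ, E) I (extChartAt I x₀).symm (Set.range I) y

/-- `vectorInChart`, for a field with values in the model space. -/
noncomputable def chartVector (X : M → E) (x₀ : M) : E → E := vectorInChart I X x₀

/-- `covectorInChart`, for a field with values in the dual of the model space. -/
noncomputable def chartCovector (α : M → E →L[ℝ] ℝ) (x₀ : M) : E → E →L[ℝ] ℝ :=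
  covectorInChart I α x₀

/-- The Lie bracket of vector fields, with values in the model space. -/
noncomputable def modelBracket (X Y : M → E) (x : M) : E := VectorField.mlieBracket I X Y x

/-- The Lie derivative of a `1`-form, with values in the dual of the model space. -/
noncomputable def modelLieDerivative (X : M → E) (α : M → E →L[ℝ] ℝ) (x : M) : E →L[ℝ] ℝ :=
  lieDerivative I X α x

/-- The differential of a function, as a linear map on the model space. -/
noncomputable def modelDeriv {F : Type*} [NormedAddCommGroup F] [NormedSpace ℝ F] (f : M → F)
    (x : M) : E →L[ℝ] F :=
  mvfderiv I f x

theorem chartVector_apply (X : M → E) (x₀ : M) (y : E) :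
    chartVector I X x₀ y = (chartFrame I x₀ y).inverse (X ((extChartAt I x₀).symm y)) := rfl

theorem chartCovector_apply (α : M → E →L[ℝ] ℝ) (x₀ : M) (y : E) :
    chartCovector I α x₀ y = (α ((extChartAt I x₀).symm y)).comp (chartFrame I x₀ y) := rfl

theorem isInvertible_chartFrame [IsManifold I ∞ M] (x₀ : M) {y : E}
    (hy : y ∈ (extChartAt I x₀).target) : (chartFrame I x₀ y).IsInvertible := by
  have : IsManifold I 1 M := .of_le (n := ∞) (by norm_cast)
  exact isInvertible_mfderivWithin_extChartAt_symm hy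

theorem modelDeriv_extChartAt_self [IsManifold I ∞ M] (x : M) :
    modelDeriv I (extChartAt I x) x = ContinuousLinearMap.id ℝ E := by
  have : IsManifold I 1 M := .of_le (n := ∞) (by norm_cast)
  exact mfderiv_extChartAt_self

/-- The tangent space at `x` is identified with `E` through the preferred chart at `x`, so the chart
has identity derivative there, and hence so has its inverse. This is what turns chart formulas at
the centre into formulas in the original fields. -/
theorem chartFrame_self [IsManifold I ∞ M] (x : M) :
    chartFrame I x (extChartAt I x x) = ContinuousLinearMap.id ℝ E := by
  have : IsManifold I 1 M := .of_le (n := ∞) (by norm_cast)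
  have h : (modelDeriv I (extChartAt I x) ((extChartAt I x).symm (extChartAt I x x))).comp
      (chartFrame I x (extChartAt I x x)) = ContinuousLinearMap.id ℝ E :=
    mfderiv_extChartAt_comp_mfderivWithin_extChartAt_symm (I := I) (x := x)
      (y := extChartAt I x x) (mem_extChartAt_target x)
  rwa [extChartAt_to_inv, modelDeriv_extChartAt_self] at h

theorem chartVector_self [IsManifold I ∞ M] (X : M → E) (x : M) :
    chartVector I X x (extChartAt I x x) = X x := by
  rw [chartVector_apply, chartFrame_self, extChartAt_to_inv, ContinuousLinearMap.inverse_id]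
  rfl

theorem chartCovector_self [IsManifold I ∞ M] (α : M → E →L[ℝ] ℝ) (x : M) :
    chartCovector I α x (extChartAt I x x) = α x := by
  rw [chartCovector_apply, chartFrame_self, extChartAt_to_inv, ContinuousLinearMap.comp_id]

/-- Vectors transform by the inverse of the frame and covectors by the frame itself, so the two
factors cancel in the pairing. -/
theorem chartCovector_chartVector [IsManifold I ∞ M] (α : M → E →L[ℝ] ℝ) (X : M → E) (x₀ : M)
    {y : E} (hy : y ∈ (extChartAt I x₀).target) :
    chartCovector I α x₀ y (chartVector I X x₀ y)
      = α ((extChartAt I x₀).symm y) (X ((extChartAt I x₀).symm y)) := by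
  rw [chartCovector_apply, chartVector_apply]
  obtain ⟨e, he⟩ := isInvertible_chartFrame I x₀ hy
  rw [← he, ContinuousLinearMap.inverse_equiv]
  exact congrArg _ (e.apply_symm_apply _)

theorem extChartAt_target_mem_nhds_self [I.Boundaryless] (x : M) :
    (extChartAt I x).target ∈ nhds (extChartAt I x x) :=
  (isOpen_extChartAt_target (I := I) x).mem_nhds (mem_extChartAt_target x)

/-- Without boundary the model has full range, so derivatives within the range are ordinary ones,
and at the centre of the chart the outer change of frame is the identity. -/
theorem modelBracket_eq [I.Boundaryless] [IsManifold I ∞ M] (X Y : M → E) (x : M) :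
    modelBracket I X Y x =
      fderiv ℝ (chartVector I Y x) (extChartAt I x x) (X x)
        - fderiv ℝ (chartVector I X x) (extChartAt I x x) (Y x) := by
  have h : modelBracket I X Y x =
      (modelDeriv I (extChartAt I x) x).inverse
        (VectorField.lieBracketWithin ℝ (chartVector I X x) (chartVector I Y x)
          ((extChartAt I x).symm ⁻¹' Set.univ ∩ Set.range I) (extChartAt I x x)) := rfl
  rw [h, modelDeriv_extChartAt_self, ContinuousLinearMap.inverse_id, I.range_eq_univ,
    Set.preimage_univ, Set.univ_inter, VectorField.lieBracketWithin_univ, VectorField.lieBracket,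
    chartVector_self, chartVector_self]
  rfl

theorem modelLieDerivative_eq [I.Boundaryless] [IsManifold I ∞ M] (X : M → E)
    (α : M → E →L[ℝ] ℝ) (x : M) :
    modelLieDerivative I X α x =
      fderiv ℝ (chartCovector I α x) (extChartAt I x x) (X x)
        + (α x).comp (fderiv ℝ (chartVector I X x) (extChartAt I x x)) := by
  have h : modelLieDerivative I X α x =
    (fderivWithin ℝ (chartCovector I α x) (Set.range I) (extChartAt I x x)
      (chartVector I X x (extChartAt I x x))
    + (chartCovector I α x (extChartAt I x x)).comp
      (fderivWithin ℝ (chartVector I X x) (Set.range I) (extChartAt I x x))).comp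
    (modelDeriv I (extChartAt I x) x) := rfl
  rw [h, modelDeriv_extChartAt_self, I.range_eq_univ, fderivWithin_univ, fderivWithin_univ,
    chartVector_self, chartCovector_self, ContinuousLinearMap.comp_id]

theorem modelDeriv_eq [I.Boundaryless] {F : Type*} [NormedAddCommGroup F] [NormedSpace ℝ F]
    {f : M → F} {x : M} (hf : MDifferentiableAt I 𝓘(ℝ, F) f x) :
    modelDeriv I f x = fderiv ℝ (f ∘ (extChartAt I x).symm) (extChartAt I x x) := by
  have h : modelDeriv I f x =
      fderivWithin ℝ (f ∘ (extChartAt I x).symm) (Set.range I) (extChartAt I x x) :=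
    if_pos hf
  rw [h, I.range_eq_univ, fderivWithin_univ]

/-! ### Smoothness of functions, vector fields and covector fields read in the preferred chart. -/

theorem contMDiffAt_iff_contDiffAt_chart [I.Boundaryless] [IsManifold I ∞ M] {F : Type*}
    [NormedAddCommGroup F] [NormedSpace ℝ F] {f : M → F} {x : M} :
    ContMDiffAt I 𝓘(ℝ, F) ∞ f x ↔
      ContDiffAt ℝ ∞ (f ∘ (extChartAt I x).symm) (extChartAt I x x) := by
  have h := contMDiffAt_iff_source_of_mem_source (I := I) (I' := 𝓘(ℝ, F)) (n := ∞) (f := f)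
    (x := x) (x' := x) (mem_chart_source H x)
  rw [h, I.range_eq_univ, contMDiffWithinAt_univ, contMDiffAt_iff_contDiffAt]

theorem contDiffAt_congr_of_eqOn_target [I.Boundaryless] {F : Type*}
    [NormedAddCommGroup F] [NormedSpace ℝ F] {x : M} {f g : E → F}
    (hfg : Set.EqOn f g (extChartAt I x).target) :
    ContDiffAt ℝ ∞ f (extChartAt I x x) ↔ ContDiffAt ℝ ∞ g (extChartAt I x x) := by
  have h := hfg.eventuallyEq_of_mem (extChartAt_target_mem_nhds_self I x)
  exact ⟨fun hf => hf.congr_of_eventuallyEq h.symm, fun hg => hg.congr_of_eventuallyEq h⟩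

/-- The inverse of the trivialization of the tangent bundle at `x`, as an endomorphism of the model
space. -/
noncomputable def modelSymmL [IsManifold I 1 M] (x x' : M) : E →L[ℝ] E :=
  (trivializationAt E (TangentSpace I) x).symmL ℝ x'

theorem modelSymmL_eq [IsManifold I 1 M] (x : M) {y : E} (hy : y ∈ (extChartAt I x).target) :
    modelSymmL I x ((extChartAt I x).symm y) = chartFrame I x y := by
  have hs : (extChartAt I x).symm y ∈ (chartAt H x).source := by
    rw [← extChartAt_source I]; exact (extChartAt I x).map_target hy
  have h : modelSymmL I x ((extChartAt I x).symm y)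
      = chartFrame I x (extChartAt I x ((extChartAt I x).symm y)) :=
    TangentBundle.symmL_trivializationAt (I := I) hs
  rwa [(extChartAt I x).right_inv hy] at h

/-- On the chart domain the bundle trivialization at `x` is the inverse of `chartFrame`, so the
trivialized section, read in the chart, is `chartVector`. -/
theorem contMDiffAt_vector_iff [I.Boundaryless] [IsManifold I ∞ M] {X : M → E} {x : M} :
    ContMDiffAt I I.tangent ∞ (fun x => (⟨x, X x⟩ : TangentBundle I M)) x ↔
      ContDiffAt ℝ ∞ (chartVector I X x) (extChartAt I x x) := by
  have : IsManifold I 1 M := .of_le (n := ∞) (by norm_cast)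
  have h := Bundle.contMDiffAt_section (IB := I) (F := E) (E := TangentSpace I (M := M)) (n := ∞)
    (s := X) x
  refine h.trans ((contMDiffAt_iff_contDiffAt_chart I).trans ?_)
  refine contDiffAt_congr_of_eqOn_target I fun y hy => ?_
  have hs : (extChartAt I x).symm y ∈ (trivializationAt E (TangentSpace I) x).baseSet := by
    rw [TangentBundle.trivializationAt_baseSet, ← extChartAt_source I]
    exact (extChartAt I x).map_target hy
  rw [chartVector_apply, ← modelSymmL_eq I x hy]
  have hi := isInvertible_chartFrame I x hy
  rw [← modelSymmL_eq I x hy] at hi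
  obtain ⟨e, he⟩ := hi
  rw [← he, ContinuousLinearMap.inverse_equiv]
  -- Instead of inverting the frame, apply it to the trivialized vector and check that this returns
  -- `X`.
  refine (e.symm_apply_eq.2 ?_).symm
  refine Eq.trans ?_ (congrArg (fun A : E →L[ℝ] E => A _) he.symm)
  have h3 := (trivializationAt E (TangentSpace I) x).symmL_continuousLinearMapAt (R := ℝ)
    (b := (extChartAt I x).symm y) hs (X ((extChartAt I x).symm y))
  have h4 := (trivializationAt E (TangentSpace I) x).continuousLinearMapAt_apply_of_mem ℝ hs
    (X ((extChartAt I x).symm y))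
  exact h3.symm.trans (congrArg (fun w : E => modelSymmL I x ((extChartAt I x).symm y) w) h4)

theorem contMDiffAt_covector_iff [I.Boundaryless] [IsManifold I ∞ M]
    {α : M → E →L[ℝ] ℝ} {x : M} :
    ContMDiffAt I (I.prod 𝓘(ℝ, E →L[ℝ] ℝ)) ∞
    (fun x => (⟨x, α x⟩ : Bundle.TotalSpace (E →L[ℝ] ℝ)
      (fun x : M => TangentSpace I x →L[ℝ] Bundle.Trivial M ℝ x))) x ↔
      ContDiffAt ℝ ∞ (chartCovector I α x) (extChartAt I x x) := by
  have : IsManifold I 1 M := .of_le (n := ∞) (by norm_cast)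
  have h := contMDiffAt_hom_bundle (IM := I) (IB := I) (n := ∞) (F₁ := E)
    (E₁ := TangentSpace I (M := M)) (F₂ := ℝ) (E₂ := Bundle.Trivial M ℝ)
    (fun x => (⟨x, α x⟩ : Bundle.TotalSpace (E →L[ℝ] ℝ)
      (fun x : M => TangentSpace I x →L[ℝ] Bundle.Trivial M ℝ x))) (x₀ := x)
  refine h.trans ((and_iff_right (contMDiffAt_id (I := I) (n := ∞) (x := x))).trans ?_)
  refine (contMDiffAt_iff_contDiffAt_chart I).trans ?_
  refine contDiffAt_congr_of_eqOn_target I fun y hy => ?_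
  rw [chartCovector_apply, ← modelSymmL_eq I x hy]
  ext v
  -- In the hom bundle the target is the trivial line bundle, whose trivialization is the identity;
  -- only the frame on the source side remains.
  change (trivializationAt ℝ (Bundle.Trivial M ℝ) x).continuousLinearMapAt ℝ _
    (α ((extChartAt I x).symm y) (modelSymmL I x ((extChartAt I x).symm y) v)) = _
  exact congrArg (fun A : ℝ →L[ℝ] ℝ =>
      A (α ((extChartAt I x).symm y) (modelSymmL I x ((extChartAt I x).symm y) v)))
    (Bundle.Trivial.continuousLinearMapAt_trivialization ℝ M ℝ ((extChartAt I x).symm y))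

end Chart

section Pairing

variable {E : Type*} [NormedAddCommGroup E] [NormedSpace ℝ E]
  {H : Type*} [TopologicalSpace H] (I : ModelWithCorners ℝ E H)
  {M : Type*} [TopologicalSpace M] [ChartedSpace H M]

/-! ### Total antisymmetry of the Courant bracket on isotropic sections -/

/-- The value of a section of `TM ⊕ T*M` as a pair of elements of the model space and its dual. -/
def bigMk (x : M) (v : E) (l : E →L[ℝ] ℝ) : BigTangent I x := (v, l)

theorem bigMetric_bigMk (x : M) (v w : E) (l m : E →L[ℝ] ℝ) :
    bigMetric I x (bigMk I x v l) (bigMk I x w m) = (1 / 2) * (m v + l w) := rfl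

/-- The contraction of a `3`-form with two vectors, as a linear map on the model space. -/
noncomputable def modelContract (Θ : Π x : M, TangentSpace I x [⋀^Fin 3]→L[ℝ] ℝ) (x : M) (v w : E) :
    E →L[ℝ] ℝ :=
  contract₃ (Θ x) v w

theorem modelContract_apply (Θ : Π x : M, TangentSpace I x [⋀^Fin 3]→L[ℝ] ℝ) (x : M)
    (u v w : E) : modelContract I Θ x u v w = Θ x ![u, v, w] :=
  contract₃_apply (Θ x) u v w

theorem courantBracket_bigMk (Θ : Π x : M, TangentSpace I x [⋀^Fin 3]→L[ℝ] ℝ) (X Y : M → E)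
    (α β : M → E →L[ℝ] ℝ) (x : M) :
    courantBracket I Θ (fun y => bigMk I y (X y) (α y)) (fun y => bigMk I y (Y y) (β y)) x =
      bigMk I x (modelBracket I X Y x)
        (modelLieDerivative I X β x - modelLieDerivative I Y α x
          - modelDeriv I (fun y => (1 / 2 : ℝ) * (β y (X y) - α y (Y y))) x
          + modelContract I Θ x (X x) (Y x)) := rfl

theorem contMDiffAt_pairing [I.Boundaryless] [IsManifold I ∞ M] {X : M → E}
    {α : M → E →L[ℝ] ℝ} {x : M} (hX : ContDiffAt ℝ ∞ (chartVector I X x) (extChartAt I x x))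
    (hα : ContDiffAt ℝ ∞ (chartCovector I α x) (extChartAt I x x)) :
    ContMDiffAt I 𝓘(ℝ) ∞ (fun y => α y (X y)) x := by
  rw [contMDiffAt_iff_contDiffAt_chart]
  refine (contDiffAt_congr_of_eqOn_target I fun y hy => ?_).1 (hα.clm_apply hX)
  exact chartCovector_chartVector I α X x hy

theorem modelDeriv_pairing [I.Boundaryless] [IsManifold I ∞ M] {X : M → E}
    {α : M → E →L[ℝ] ℝ} {x : M} (hX : ContDiffAt ℝ ∞ (chartVector I X x) (extChartAt I x x))
    (hα : ContDiffAt ℝ ∞ (chartCovector I α x) (extChartAt I x x)) (w : E) :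
    modelDeriv I (fun y => α y (X y)) x w =
      fderiv ℝ (chartCovector I α x) (extChartAt I x x) w (X x)
        + α x (fderiv ℝ (chartVector I X x) (extChartAt I x x) w) := by
  have h : (fun y => α y (X y)) ∘ (extChartAt I x).symm
      =ᶠ[nhds (extChartAt I x x)] fun y => chartCovector I α x y (chartVector I X x y) := by
    filter_upwards [extChartAt_target_mem_nhds_self I x] with y hy
    exact (chartCovector_chartVector I α X x hy).symm
  rw [modelDeriv_eq I ((contMDiffAt_pairing I hX hα).mdifferentiableAt (by simp)), h.fderiv_eq,
    fderiv_clm_apply (hα.differentiableAt (by simp)) (hX.differentiableAt (by simp)),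
    chartVector_self, chartCovector_self, add_comm]
  rfl

theorem ContinuousAlternatingMap.map_rotate_three {V : Type*} [AddCommGroup V] [Module ℝ V]
    [TopologicalSpace V] (η : V [⋀^Fin 3]→L[ℝ] ℝ) (a b c : V) : η ![a, b, c] = η ![b, c, a] := by
  have h1 := η.toAlternatingMap.map_perm ![b, c, a] (finRotate 3)⁻¹
  -- A rotation of three letters is an even permutation, so no sign appears.
  have h2 : ![b, c, a] ∘ ((finRotate 3)⁻¹ : Equiv.Perm (Fin 3)) = ![a, b, c] := by
    ext i; fin_cases i <;> rfl
  rw [h2, Equiv.Perm.sign_inv, sign_finRotate] at h1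
  simpa using h1

variable [I.Boundaryless] [IsManifold I ∞ M] (Θ : Π x : M, TangentSpace I x [⋀^Fin 3]→L[ℝ] ℝ)
  {X Y Z : M → E} {α β γ : M → E →L[ℝ] ℝ} {x : M}
  (hX : ContDiffAt ℝ ∞ (chartVector I X x) (extChartAt I x x))
  (hα : ContDiffAt ℝ ∞ (chartCovector I α x) (extChartAt I x x))
  (hY : ContDiffAt ℝ ∞ (chartVector I Y x) (extChartAt I x x))
  (hβ : ContDiffAt ℝ ∞ (chartCovector I β x) (extChartAt I x x))
  (hZ : ContDiffAt ℝ ∞ (chartVector I Z x) (extChartAt I x x))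
  (hγ : ContDiffAt ℝ ∞ (chartCovector I γ x) (extChartAt I x x))
  (hXY : ∀ y, β y (X y) + α y (Y y) = 0)
  (hYZ : ∀ y, γ y (Y y) + β y (Z y) = 0)
  (hXZ : ∀ y, γ y (X y) + α y (Z y) = 0)

-- This is the derivative in the direction `w` of the identity `β(X) + α(Y) = 0`. Orthogonality on
-- the whole manifold is used, not just at `x`.
include hX hα hY hβ hXY in
theorem fderiv_isotropic (w : E) :
    fderiv ℝ (chartCovector I β x) (extChartAt I x x) w (X x)
        + β x (fderiv ℝ (chartVector I X x) (extChartAt I x x) w)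
        + fderiv ℝ (chartCovector I α x) (extChartAt I x x) w (Y x)
        + α x (fderiv ℝ (chartVector I Y x) (extChartAt I x x) w) = 0 := by
  have h1 := modelDeriv_pairing I hX hβ w
  have h2 := modelDeriv_pairing I hY hα w
  have h3 : (fun y => β y (X y)) = fun y => -(α y (Y y)) := by
    funext y; linarith [hXY y]
  have h4 : modelDeriv I (fun y => -(α y (Y y))) x = -modelDeriv I (fun y => α y (Y y)) x :=
    mvfderiv_neg
  rw [h3, h4, neg_apply] at h1
  linarith

-- Orthogonality replaces `½(β(X) - α(Y))` by `β(X)`. The differential of `β(X)` then cancels the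
-- term `β ∘ DX` of `L_X β`, leaving an expression in which `v ⊕ l` is not differentiated.
include hX hβ hXY in
theorem bigMetric_courantBracket (v : E) (l : E →L[ℝ] ℝ) :
    bigMetric I x (courantBracket I Θ (fun y => bigMk I y (X y) (α y))
        (fun y => bigMk I y (Y y) (β y)) x) (bigMk I x v l) =
      (1 / 2) * (l (fderiv ℝ (chartVector I Y x) (extChartAt I x x) (X x)
          - fderiv ℝ (chartVector I X x) (extChartAt I x x) (Y x))
        + fderiv ℝ (chartCovector I β x) (extChartAt I x x) (X x) v
        - fderiv ℝ (chartCovector I α x) (extChartAt I x x) (Y x) v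
        - α x (fderiv ℝ (chartVector I Y x) (extChartAt I x x) v)
        - fderiv ℝ (chartCovector I β x) (extChartAt I x x) v (X x)
        + Θ x ![X x, Y x, v]) := by
  have h : (fun y => (1 / 2 : ℝ) * (β y (X y) - α y (Y y))) = fun y => β y (X y) := by
    funext y; linarith [hXY y]
  rw [courantBracket_bigMk, bigMetric_bigMk, h, modelBracket_eq, modelLieDerivative_eq,
    modelLieDerivative_eq]
  simp only [add_apply, sub_apply,
    ContinuousLinearMap.comp_apply, modelDeriv_pairing I hX hβ, modelContract_apply]
  ring_nf

-- After the previous formula both sides share the derivatives along `Z`. The remaining difference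
-- is killed by differentiating the orthogonality of the last two sections along `X` and that of the
-- outer two along `Y`; the twist is invariant under rotation.
include hX hα hY hβ hZ hγ hXY hYZ hXZ in
theorem bigMetric_courantBracket_rotate :
    bigMetric I x (courantBracket I Θ (fun y => bigMk I y (X y) (α y))
        (fun y => bigMk I y (Y y) (β y)) x) (bigMk I x (Z x) (γ x)) =
    bigMetric I x (courantBracket I Θ (fun y => bigMk I y (Y y) (β y))
        (fun y => bigMk I y (Z y) (γ y)) x) (bigMk I x (X x) (α x)) := by
  rw [bigMetric_courantBracket I Θ hX hβ hXY, bigMetric_courantBracket I Θ hY hγ hYZ]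
  have h1 := fderiv_isotropic I hY hβ hZ hγ hYZ (X x)
  have h2 := fderiv_isotropic I hX hα hZ hγ hXZ (Y x)
  have h3 : Θ x ![X x, Y x, Z x] = Θ x ![Y x, Z x, X x] :=
    ContinuousAlternatingMap.map_rotate_three (Θ x) (X x) (Y x) (Z x)
  rw [h3, map_sub, map_sub]
  linarith

end Pairing

section Product

variable {E : Type*} [NormedAddCommGroup E] [NormedSpace ℝ E]
  {H : Type*} [TopologicalSpace H] (I : ModelWithCorners ℝ E H)
  {M : Type*} [TopologicalSpace M] [ChartedSpace H M] {h : ℕ}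

/-! ### Charts of `M × ℝ^h` -/

theorem extChartAt_prodModel (p q : M × EuclideanSpace ℝ (Fin h)) :
    extChartAt (prodModel I h) p q = (extChartAt I p.1 q.1, q.2) := by
  rw [extChartAt_prod]
  rfl

theorem extChartAt_prodModel_symm (p : M × EuclideanSpace ℝ (Fin h))
    (y : E × EuclideanSpace ℝ (Fin h)) :
    (extChartAt (prodModel I h) p).symm y = ((extChartAt I p.1).symm y.1, y.2) := by
  rw [extChartAt_prod]
  rfl

theorem mem_extChartAt_prodModel_target (p : M × EuclideanSpace ℝ (Fin h))
    {y : E × EuclideanSpace ℝ (Fin h)} :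
    y ∈ (extChartAt (prodModel I h) p).target ↔ y.1 ∈ (extChartAt I p.1).target := by
  rw [extChartAt_prod, PartialEquiv.prod_target, Set.mem_prod, extChartAt_model_space_eq_id]
  exact and_iff_left trivial

/-- The preferred charts of the product are products with the identity of `ℝ^h`, so the frame acts
on the `E` factor only. -/
theorem chartFrame_prodModel [IsManifold I ∞ M] (p : M × EuclideanSpace ℝ (Fin h))
    {y : E × EuclideanSpace ℝ (Fin h)} (hy : y.1 ∈ (extChartAt I p.1).target) :
    chartFrame (prodModel I h) p y =
      (chartFrame I p.1 y.1).prodMap (ContinuousLinearMap.id ℝ _) := by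
  have : IsManifold I 1 M := .of_le (n := ∞) (by norm_cast)
  have h0 : chartFrame (prodModel I h) p y = mfderivWithin 𝓘(ℝ, E × EuclideanSpace ℝ (Fin h))
      (prodModel I h) (extChartAt (prodModel I h) p).symm (Set.range (prodModel I h)) y := rfl
  have h1 : ((extChartAt (prodModel I h) p).symm : E × EuclideanSpace ℝ (Fin h) → _)
      = Prod.map (extChartAt I p.1).symm id := by
    funext z
    exact extChartAt_prodModel_symm I p z
  have h2 : Set.range (prodModel I h) = Set.range I ×ˢ Set.univ := by
    rw [modelWithCorners_prod_coe, Set.range_prodMap]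
    simp
  have hy' : y.1 ∈ Set.range I := extChartAt_target_subset_range _ hy
  have h3 := mfderivWithin_prodMap (I := 𝓘(ℝ, E)) (J := I)
    (I' := 𝓘(ℝ, EuclideanSpace ℝ (Fin h))) (J' := 𝓘(ℝ, EuclideanSpace ℝ (Fin h)))
    (p := y) (s := Set.range I) (t := Set.univ) (f := (extChartAt I p.1).symm)
    (g := (id : EuclideanSpace ℝ (Fin h) → EuclideanSpace ℝ (Fin h)))
    (mdifferentiableWithinAt_extChartAt_symm hy) mdifferentiableWithinAt_id
    (I.uniqueMDiffOn _ hy') (uniqueMDiffWithinAt_univ _)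
  rw [mfderivWithin_univ, mfderiv_id] at h3
  rw [h0, h1, h2, modelWithCornersSelf_prod, ← chartedSpaceSelf_prod]
  exact h3

theorem chartVector_prodModel [IsManifold I ∞ M]
    (Y : M × EuclideanSpace ℝ (Fin h) → E × EuclideanSpace ℝ (Fin h))
    (p : M × EuclideanSpace ℝ (Fin h)) {y : E × EuclideanSpace ℝ (Fin h)}
    (hy : y.1 ∈ (extChartAt I p.1).target) :
    chartVector (prodModel I h) Y p y =
      ((chartFrame I p.1 y.1).inverse (Y ((extChartAt I p.1).symm y.1, y.2)).1,
        (Y ((extChartAt I p.1).symm y.1, y.2)).2) := by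
  rw [chartVector_apply, chartFrame_prodModel I p hy, extChartAt_prodModel_symm]
  obtain ⟨e, he⟩ := isInvertible_chartFrame I p.1 hy
  rw [← he, ContinuousLinearMap.inverse_equiv]
  have : (e : E →L[ℝ] E).prodMap (ContinuousLinearMap.id ℝ (EuclideanSpace ℝ (Fin h)))
    = (e.prodCongr (ContinuousLinearEquiv.refl ℝ (EuclideanSpace ℝ (Fin h))) :
      (E × EuclideanSpace ℝ (Fin h)) →L[ℝ] (E × EuclideanSpace ℝ (Fin h))) := rfl
  rw [this, ContinuousLinearMap.inverse_equiv]
  rfl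

theorem chartCovector_prodModel [IsManifold I ∞ M]
    (β : M × EuclideanSpace ℝ (Fin h) → (E × EuclideanSpace ℝ (Fin h)) →L[ℝ] ℝ)
    (p : M × EuclideanSpace ℝ (Fin h)) {y : E × EuclideanSpace ℝ (Fin h)}
    (hy : y.1 ∈ (extChartAt I p.1).target) :
    chartCovector (prodModel I h) β p y =
      (β ((extChartAt I p.1).symm y.1, y.2)).comp
        ((chartFrame I p.1 y.1).prodMap (ContinuousLinearMap.id ℝ _)) := by
  rw [chartCovector_apply, chartFrame_prodModel I p hy, extChartAt_prodModel_symm]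

/-- The covector `(X, u) ↦ α(X) + v · u`. -/
noncomputable def prodCovector (α : E →L[ℝ] ℝ) (v : EuclideanSpace ℝ (Fin h)) :
    (E × EuclideanSpace ℝ (Fin h)) →L[ℝ] ℝ :=
  α.comp (ContinuousLinearMap.fst ℝ E _) + (innerSL ℝ v).comp (ContinuousLinearMap.snd ℝ E _)

theorem prodCovector_apply (α : E →L[ℝ] ℝ) (v : EuclideanSpace ℝ (Fin h))
    (w : E × EuclideanSpace ℝ (Fin h)) : prodCovector α v w = α w.1 + inner ℝ v w.2 := rfl

theorem chartVector_lift [IsManifold I ∞ M] (X : M → E) (u : M → EuclideanSpace ℝ (Fin h))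
    (p : M × EuclideanSpace ℝ (Fin h)) {y : E × EuclideanSpace ℝ (Fin h)}
    (hy : y.1 ∈ (extChartAt I p.1).target) :
    chartVector (prodModel I h) (fun q => (X q.1, u q.1)) p y =
      (chartVector I X p.1 y.1, (u ∘ (extChartAt I p.1).symm) y.1) :=
  chartVector_prodModel I _ p hy

theorem chartCovector_lift [IsManifold I ∞ M] (α : M → E →L[ℝ] ℝ)
    (v : M → EuclideanSpace ℝ (Fin h))
    (p : M × EuclideanSpace ℝ (Fin h)) {y : E × EuclideanSpace ℝ (Fin h)}
    (hy : y.1 ∈ (extChartAt I p.1).target) :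
    chartCovector (prodModel I h) (fun q => prodCovector (α q.1) (v q.1)) p y =
      prodCovector (chartCovector I α p.1 y.1) ((v ∘ (extChartAt I p.1).symm) y.1) := by
  rw [chartCovector_prodModel I _ p hy]
  rfl

/-- The inner product of `ℝ^h` as a continuous bilinear map. -/
noncomputable def euclideanInnerL (h : ℕ) :
    EuclideanSpace ℝ (Fin h) →L[ℝ] EuclideanSpace ℝ (Fin h) →L[ℝ] ℝ :=
  LinearMap.toContinuousLinearMap
    { toFun := fun v => innerSL ℝ v
      map_add' := fun v w => map_add _ v w
      map_smul' := fun c v => by ext w; simp }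

/-- `prodCovector` as a continuous linear map in both arguments. -/
noncomputable def prodCovectorL : ((E →L[ℝ] ℝ) × EuclideanSpace ℝ (Fin h)) →L[ℝ]
    ((E × EuclideanSpace ℝ (Fin h)) →L[ℝ] ℝ) :=
  ((ContinuousLinearMap.compL ℝ (E × EuclideanSpace ℝ (Fin h)) E ℝ).flip
      (ContinuousLinearMap.fst ℝ E (EuclideanSpace ℝ (Fin h)))).comp
    (ContinuousLinearMap.fst ℝ _ _)
  + (((ContinuousLinearMap.compL ℝ (E × EuclideanSpace ℝ (Fin h)) (EuclideanSpace ℝ (Fin h)) ℝ).flip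
      (ContinuousLinearMap.snd ℝ E (EuclideanSpace ℝ (Fin h)))).comp (euclideanInnerL h)).comp
    (ContinuousLinearMap.snd ℝ _ _)

theorem hasFDerivAt_comp_fst {F G : Type*} [NormedAddCommGroup F] [NormedSpace ℝ F]
    [NormedAddCommGroup G] [NormedSpace ℝ G] {f : E → F} {f' : E →L[ℝ] F} {a : E} (t : G)
    (hf : HasFDerivAt f f' a) :
    HasFDerivAt (fun y : E × G => f y.1) (f'.comp (ContinuousLinearMap.fst ℝ E G)) (a, t) :=
  HasFDerivAt.comp (a, t) hf hasFDerivAt_fst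

theorem contDiffAt_comp_fst {F G : Type*} [NormedAddCommGroup F] [NormedSpace ℝ F]
    [NormedAddCommGroup G] [NormedSpace ℝ G] {f : E → F} {a : E} (t : G)
    (hf : ContDiffAt ℝ ∞ f a) : ContDiffAt ℝ ∞ (fun y : E × G => f y.1) (a, t) :=
  ContDiffAt.comp (a, t) hf contDiffAt_fst

variable [I.Boundaryless] [IsManifold I ∞ M]

omit [IsManifold I ∞ M] in
theorem extChartAt_prodModel_target_mem_nhds (p : M × EuclideanSpace ℝ (Fin h)) :
    ∀ᶠ y in nhds (extChartAt (prodModel I h) p p), y.1 ∈ (extChartAt I p.1).target := by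
  filter_upwards [extChartAt_target_mem_nhds_self (prodModel I h) p] with y hy
  exact (mem_extChartAt_prodModel_target I p).1 hy

theorem contDiffAt_chartVector_lift {X : M → E} {u : M → EuclideanSpace ℝ (Fin h)}
    {p : M × EuclideanSpace ℝ (Fin h)}
    (hX : ContDiffAt ℝ ∞ (chartVector I X p.1) (extChartAt I p.1 p.1))
    (hu : ContDiffAt ℝ ∞ (u ∘ (extChartAt I p.1).symm) (extChartAt I p.1 p.1)) :
    ContDiffAt ℝ ∞ (chartVector (prodModel I h) (fun q => (X q.1, u q.1)) p)
      (extChartAt (prodModel I h) p p) := by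
  have h1 : ContDiffAt ℝ ∞ (fun y : E × EuclideanSpace ℝ (Fin h) =>
      (chartVector I X p.1 y.1, (u ∘ (extChartAt I p.1).symm) y.1))
      (extChartAt (prodModel I h) p p) := by
    rw [extChartAt_prodModel]
    exact (contDiffAt_comp_fst p.2 hX).prodMk (contDiffAt_comp_fst p.2 hu)
  refine h1.congr_of_eventuallyEq ?_
  filter_upwards [extChartAt_prodModel_target_mem_nhds I p] with y hy
  exact chartVector_lift I X u p hy

theorem contDiffAt_chartCovector_lift {α : M → E →L[ℝ] ℝ} {v : M → EuclideanSpace ℝ (Fin h)}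
    {p : M × EuclideanSpace ℝ (Fin h)}
    (hα : ContDiffAt ℝ ∞ (chartCovector I α p.1) (extChartAt I p.1 p.1))
    (hv : ContDiffAt ℝ ∞ (v ∘ (extChartAt I p.1).symm) (extChartAt I p.1 p.1)) :
    ContDiffAt ℝ ∞ (chartCovector (prodModel I h) (fun q => prodCovector (α q.1) (v q.1)) p)
      (extChartAt (prodModel I h) p p) := by
  have h1 : ContDiffAt ℝ ∞ (fun y : E × EuclideanSpace ℝ (Fin h) =>
      prodCovectorL (chartCovector I α p.1 y.1, (v ∘ (extChartAt I p.1).symm) y.1))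
      (extChartAt (prodModel I h) p p) := by
    rw [extChartAt_prodModel]
    exact (prodCovectorL (E := E) (h := h)).contDiff.contDiffAt.comp _
      ((contDiffAt_comp_fst p.2 hα).prodMk (contDiffAt_comp_fst p.2 hv))
  refine h1.congr_of_eventuallyEq ?_
  filter_upwards [extChartAt_prodModel_target_mem_nhds I p] with y hy
  exact chartCovector_lift I α v p hy

theorem fderiv_chartVector_lift {X : M → E} {u : M → EuclideanSpace ℝ (Fin h)}
    {p : M × EuclideanSpace ℝ (Fin h)}
    (hX : ContDiffAt ℝ ∞ (chartVector I X p.1) (extChartAt I p.1 p.1))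
    (hu : ContMDiffAt I 𝓘(ℝ, EuclideanSpace ℝ (Fin h)) ∞ u p.1)
    (w : E × EuclideanSpace ℝ (Fin h)) :
    fderiv ℝ (chartVector (prodModel I h) (fun q => (X q.1, u q.1)) p)
      (extChartAt (prodModel I h) p p) w =
    (fderiv ℝ (chartVector I X p.1) (extChartAt I p.1 p.1) w.1, modelDeriv I u p.1 w.1) := by
  have h1 : HasFDerivAt (fun y : E × EuclideanSpace ℝ (Fin h) =>
      (chartVector I X p.1 y.1, (u ∘ (extChartAt I p.1).symm) y.1))
      (((fderiv ℝ (chartVector I X p.1) (extChartAt I p.1 p.1)).comp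
        (ContinuousLinearMap.fst ℝ E _)).prod ((modelDeriv I u p.1).comp
        (ContinuousLinearMap.fst ℝ E _))) (extChartAt (prodModel I h) p p) := by
    rw [extChartAt_prodModel, modelDeriv_eq I (hu.mdifferentiableAt (by simp))]
    rw [contMDiffAt_iff_contDiffAt_chart] at hu
    exact (hasFDerivAt_comp_fst p.2 (hX.differentiableAt (by simp)).hasFDerivAt).prodMk
      (hasFDerivAt_comp_fst p.2 (hu.differentiableAt (by simp)).hasFDerivAt)
  have h2 := h1.congr_of_eventuallyEq
    (f₁ := chartVector (prodModel I h) (fun q => (X q.1, u q.1)) p) (by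
      filter_upwards [extChartAt_prodModel_target_mem_nhds I p] with y hy
      exact chartVector_lift I X u p hy)
  rw [h2.fderiv]
  rfl

theorem fderiv_chartCovector_lift {α : M → E →L[ℝ] ℝ} {v : M → EuclideanSpace ℝ (Fin h)}
    {p : M × EuclideanSpace ℝ (Fin h)}
    (hα : ContDiffAt ℝ ∞ (chartCovector I α p.1) (extChartAt I p.1 p.1))
    (hv : ContMDiffAt I 𝓘(ℝ, EuclideanSpace ℝ (Fin h)) ∞ v p.1)
    (w : E × EuclideanSpace ℝ (Fin h)) :
    fderiv ℝ (chartCovector (prodModel I h) (fun q => prodCovector (α q.1) (v q.1)) p)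
      (extChartAt (prodModel I h) p p) w =
    prodCovector (fderiv ℝ (chartCovector I α p.1) (extChartAt I p.1 p.1) w.1)
      (modelDeriv I v p.1 w.1) := by
  have h1 : HasFDerivAt (fun y : E × EuclideanSpace ℝ (Fin h) =>
      (chartCovector I α p.1 y.1, (v ∘ (extChartAt I p.1).symm) y.1))
      (((fderiv ℝ (chartCovector I α p.1) (extChartAt I p.1 p.1)).comp
        (ContinuousLinearMap.fst ℝ E _)).prod ((modelDeriv I v p.1).comp
        (ContinuousLinearMap.fst ℝ E _))) (extChartAt (prodModel I h) p p) := by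
    rw [extChartAt_prodModel, modelDeriv_eq I (hv.mdifferentiableAt (by simp))]
    rw [contMDiffAt_iff_contDiffAt_chart] at hv
    exact (hasFDerivAt_comp_fst p.2 (hα.differentiableAt (by simp)).hasFDerivAt).prodMk
      (hasFDerivAt_comp_fst p.2 (hv.differentiableAt (by simp)).hasFDerivAt)
  have h2 := ((prodCovectorL (E := E) (h := h)).hasFDerivAt.comp _ h1).congr_of_eventuallyEq
    (f₁ := chartCovector (prodModel I h) (fun q => prodCovector (α q.1) (v q.1)) p) (by
      filter_upwards [extChartAt_prodModel_target_mem_nhds I p] with y hy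
      exact chartCovector_lift I α v p hy)
  rw [h2.fderiv]
  rfl

theorem modelDeriv_comp_fst {F : Type*} [NormedAddCommGroup F] [NormedSpace ℝ F] {f : M → F}
    {p : M × EuclideanSpace ℝ (Fin h)} (hf : ContMDiffAt I 𝓘(ℝ, F) ∞ f p.1)
    (w : E × EuclideanSpace ℝ (Fin h)) :
    modelDeriv (prodModel I h) (fun q => f q.1) p w = modelDeriv I f p.1 w.1 := by
  have hf' : ContMDiffAt (prodModel I h) 𝓘(ℝ, F) ∞
    (fun q : M × EuclideanSpace ℝ (Fin h) => f q.1) p := hf.comp p contMDiffAt_fst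
  rw [modelDeriv_eq I (hf.mdifferentiableAt (by simp)),
    modelDeriv_eq _ (hf'.mdifferentiableAt (by simp))]
  rw [contMDiffAt_iff_contDiffAt_chart] at hf
  have h1 : (fun q : M × EuclideanSpace ℝ (Fin h) => f q.1) ∘ (extChartAt (prodModel I h) p).symm
      = (f ∘ (extChartAt I p.1).symm) ∘ Prod.fst := by
    funext y
    simp only [Function.comp, extChartAt_prodModel_symm]
  rw [h1, extChartAt_prodModel, HasFDerivAt.fderiv (HasFDerivAt.comp (extChartAt I p.1 p.1, p.2)
    (hf.differentiableAt (by simp)).hasFDerivAt hasFDerivAt_fst)]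
  rfl

end Product

section Bracket

variable {E : Type*} [NormedAddCommGroup E] [NormedSpace ℝ E]
  {H : Type*} [TopologicalSpace H] (I : ModelWithCorners ℝ E H)
  {M : Type*} [TopologicalSpace M] [ChartedSpace H M] {h : ℕ}

/-! ### The bracket of lifted sections -/

/-- The element `(v, u) ⊕ (l, w)` of the stable big tangent bundle. -/
def stableMk (x : M) (v : E) (u : EuclideanSpace ℝ (Fin h)) (l : E →L[ℝ] ℝ)
    (w : EuclideanSpace ℝ (Fin h)) : StableBigTangent I h x :=
  ((v, u), (l, w))

/-- The contraction of a `2`-form with a vector, as a linear map on the model space. -/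
noncomputable def modelContract₂ (η : Π x : M, TangentSpace I x [⋀^Fin 2]→L[ℝ] ℝ) (x : M)
    (v : E) : E →L[ℝ] ℝ :=
  contract₂ (η x) v

theorem modelContract₂_apply (η : Π x : M, TangentSpace I x [⋀^Fin 2]→L[ℝ] ℝ) (x : M)
    (u v : E) : modelContract₂ I η x u v = η x ![u, v] :=
  contract₂_apply (η x) u v

theorem stableBracket_stableMk (Φ : Π x : M, TangentSpace I x [⋀^Fin 3]→L[ℝ] ℝ)
    (Ψ : Fin h → Π x : M, TangentSpace I x [⋀^Fin 2]→L[ℝ] ℝ)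
    (X₁ X₂ : M → E) (u₁ u₂ v₁ v₂ : M → EuclideanSpace ℝ (Fin h)) (α₁ α₂ : M → E →L[ℝ] ℝ) (x : M) :
    stableBracket I Φ Ψ (fun y => stableMk I y (X₁ y) (u₁ y) (α₁ y) (v₁ y))
        (fun y => stableMk I y (X₂ y) (u₂ y) (α₂ y) (v₂ y)) x =
      stableMk I x (modelBracket I X₁ X₂ x)
        (modelDeriv I u₂ x (X₁ x) - modelDeriv I u₁ x (X₂ x))
        (modelLieDerivative I X₁ α₂ x - modelLieDerivative I X₂ α₁ x
          + (1 / 2 : ℝ) • modelDeriv I (fun y => α₁ y (X₂ y) - α₂ y (X₁ y)) x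
          + modelContract I Φ x (X₁ x) (X₂ x)
          + ∑ a, u₁ x a • modelContract₂ I (Ψ a) x (X₂ x)
          - ∑ a, u₂ x a • modelContract₂ I (Ψ a) x (X₁ x)
          + (1 / 2 : ℝ) • ((innerSL ℝ (u₂ x)).comp (modelDeriv I v₁ x)
            + (innerSL ℝ (v₂ x)).comp (modelDeriv I u₁ x)
            - (innerSL ℝ (u₁ x)).comp (modelDeriv I v₂ x)
            - (innerSL ℝ (v₁ x)).comp (modelDeriv I u₂ x)))
        (modelDeriv I v₂ x (X₁ x) - modelDeriv I v₁ x (X₂ x)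
          + WithLp.toLp 2 (fun a => modelContract₂ I (Ψ a) x (X₁ x) (X₂ x))) := by
  simp only [modelContract₂_apply]
  rfl

theorem mfderiv_fst_prodModel (p : M × EuclideanSpace ℝ (Fin h)) :
    (mfderiv (prodModel I h) I Prod.fst p : TangentSpace (prodModel I h) p →L[ℝ] E)
      = ContinuousLinearMap.fst ℝ E (EuclideanSpace ℝ (Fin h)) := mfderiv_fst

theorem mvfderiv_snd_prodModel (p : M × EuclideanSpace ℝ (Fin h)) :
    mvfderiv (prodModel I h) Prod.snd p
      = ContinuousLinearMap.snd ℝ E (EuclideanSpace ℝ (Fin h)) := mfderiv_snd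

theorem mvfderiv_coord_prodModel (p : M × EuclideanSpace ℝ (Fin h)) (a : Fin h)
    (w : E × EuclideanSpace ℝ (Fin h)) :
    mvfderiv (prodModel I h) (fun q : M × EuclideanSpace ℝ (Fin h) => q.2 a) p w = w.2 a := by
  have h1 : HasMFDerivAt 𝓘(ℝ, EuclideanSpace ℝ (Fin h)) 𝓘(ℝ)
    (EuclideanSpace.proj a : EuclideanSpace ℝ (Fin h) →L[ℝ] ℝ) p.2 (EuclideanSpace.proj a) :=
    (EuclideanSpace.proj (𝕜 := ℝ) a).hasMFDerivAt
  have h2 := (h1.comp p (hasMFDerivAt_snd (I := I) p)).mfderiv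
  exact congrArg (fun A : (E × EuclideanSpace ℝ (Fin h)) →L[ℝ] ℝ => A w) h2

theorem liftAt_stableMk (p : M × EuclideanSpace ℝ (Fin h)) (v : E) (u : EuclideanSpace ℝ (Fin h))
    (l : E →L[ℝ] ℝ) (w : EuclideanSpace ℝ (Fin h)) :
    liftAt I p (stableMk I p.1 v u l w) = bigMk (prodModel I h) p (v, u) (prodCovector l w) := by
  have h1 : liftAt I p (stableMk I p.1 v u l w) = bigMk (prodModel I h) p (v, u)
    (l.comp (mfderiv (prodModel I h) I Prod.fst p)
      + (innerSL ℝ w).comp (mvfderiv (prodModel I h) Prod.snd p)) := rfl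
  rw [h1]
  refine congrArg (bigMk (prodModel I h) p (v, u)) (ContinuousLinearMap.ext fun z => ?_)
  refine congrArg₂ (fun a b : ℝ => a + b) ?_ ?_
  · exact congrArg (fun A : (E × EuclideanSpace ℝ (Fin h)) →L[ℝ] E => l (A z))
      (mfderiv_fst_prodModel I p)
  · exact congrArg (fun A : (E × EuclideanSpace ℝ (Fin h)) →L[ℝ] EuclideanSpace ℝ (Fin h) =>
      inner ℝ w (A z)) (mvfderiv_snd_prodModel I p)

/-- In the model the differential of the projection to `M` is the first projection, and `dt^i` reads
off the `i`-th coordinate of the second component. -/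
theorem twistForm_apply (Φ : Π x : M, TangentSpace I x [⋀^Fin 3]→L[ℝ] ℝ)
    (Ψ : Fin h → Π x : M, TangentSpace I x [⋀^Fin 2]→L[ℝ] ℝ) (p : M × EuclideanSpace ℝ (Fin h))
    (a b c : E × EuclideanSpace ℝ (Fin h)) :
    modelContract (prodModel I h) (twistForm I Φ Ψ) p a b c =
      modelContract I Φ p.1 a.1 b.1 c.1
        + ∑ i, (a.2 i * modelContract₂ I (Ψ i) p.1 b.1 c.1
          - b.2 i * modelContract₂ I (Ψ i) p.1 a.1 c.1
          + c.2 i * modelContract₂ I (Ψ i) p.1 a.1 b.1) := by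
  simp only [modelContract_apply, modelContract₂_apply]
  have hf (z : E × EuclideanSpace ℝ (Fin h)) : mfderiv (prodModel I h) I Prod.fst p z = z.1 :=
    congrArg (fun A : (E × EuclideanSpace ℝ (Fin h)) →L[ℝ] E => A z) (mfderiv_fst_prodModel I p)
  have h1 : (Φ p.1).compContinuousLinearMap (mfderiv (prodModel I h) I Prod.fst p) ![a, b, c]
      = Φ p.1 ![a.1, b.1, c.1] := by
    refine congrArg (Φ p.1) ?_
    funext i; fin_cases i
    exacts [hf a, hf b, hf c]
  have h2 (i : Fin h) (y z : E × EuclideanSpace ℝ (Fin h)) :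
      (Ψ i p.1).compContinuousLinearMap (mfderiv (prodModel I h) I Prod.fst p) ![y, z]
      = Ψ i p.1 ![y.1, z.1] := by
    refine congrArg (Ψ i p.1) ?_
    funext i; fin_cases i
    exacts [hf y, hf z]
  have h3 : twistForm I Φ Ψ p ![a, b, c] =
      (Φ p.1).compContinuousLinearMap (mfderiv (prodModel I h) I Prod.fst p) ![a, b, c]
      + ∑ i, wedge (mvfderiv (prodModel I h) (fun q : M × EuclideanSpace ℝ (Fin h) => q.2 i) p)
        ((Ψ i p.1).compContinuousLinearMap (mfderiv (prodModel I h) I Prod.fst p)) ![a, b, c] := by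
    rw [twistForm, ContinuousAlternatingMap.add_apply, ContinuousAlternatingMap.sum_apply]
  refine h3.trans ?_
  rw [h1]
  refine congrArg _ (Finset.sum_congr rfl fun i _ => ?_)
  rw [← h2, ← h2, ← h2, ← mvfderiv_coord_prodModel I p i a, ← mvfderiv_coord_prodModel I p i b,
    ← mvfderiv_coord_prodModel I p i c]
  exact wedge_apply (V := TangentSpace (prodModel I h) p) _ _ a b c

theorem modelDeriv_inner [I.Boundaryless] [IsManifold I ∞ M] {u v : M → EuclideanSpace ℝ (Fin h)}
    {x : M} (hu : ContMDiffAt I 𝓘(ℝ, EuclideanSpace ℝ (Fin h)) ∞ u x)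
    (hv : ContMDiffAt I 𝓘(ℝ, EuclideanSpace ℝ (Fin h)) ∞ v x) (w : E) :
    modelDeriv I (fun y => inner ℝ (u y) (v y)) x w =
      inner ℝ (u x) (modelDeriv I v x w) + inner ℝ (v x) (modelDeriv I u x w) := by
  have huv : ContMDiffAt I 𝓘(ℝ) ∞ (fun y => (inner ℝ (u y) (v y) : ℝ)) x := by
    rw [contMDiffAt_iff_contDiffAt_chart] at hu hv ⊢
    exact hu.inner ℝ hv
  rw [modelDeriv_eq I (huv.mdifferentiableAt (by simp)),
    modelDeriv_eq I (hu.mdifferentiableAt (by simp)),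
    modelDeriv_eq I (hv.mdifferentiableAt (by simp))]
  rw [contMDiffAt_iff_contDiffAt_chart] at hu hv
  have h1 := fderiv_inner_apply ℝ (hu.differentiableAt (by simp)) (hv.differentiableAt (by simp)) w
  refine h1.trans ?_
  simp only [Function.comp, extChartAt_to_inv]
  rw [real_inner_comm (v x)]

variable [I.Boundaryless] [IsManifold I ∞ M] (Φ : Π x : M, TangentSpace I x [⋀^Fin 3]→L[ℝ] ℝ)
  (Ψ : Fin h → Π x : M, TangentSpace I x [⋀^Fin 2]→L[ℝ] ℝ)
  {X₁ X₂ : M → E} {u₁ u₂ v₁ v₂ : M → EuclideanSpace ℝ (Fin h)} {α₁ α₂ : M → E →L[ℝ] ℝ}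
  {p : M × EuclideanSpace ℝ (Fin h)}

theorem modelBracket_lift
    (hX₁ : ContDiffAt ℝ ∞ (chartVector I X₁ p.1) (extChartAt I p.1 p.1))
    (hX₂ : ContDiffAt ℝ ∞ (chartVector I X₂ p.1) (extChartAt I p.1 p.1))
    (hu₁ : ContMDiffAt I 𝓘(ℝ, EuclideanSpace ℝ (Fin h)) ∞ u₁ p.1)
    (hu₂ : ContMDiffAt I 𝓘(ℝ, EuclideanSpace ℝ (Fin h)) ∞ u₂ p.1) :
    modelBracket (prodModel I h) (fun q => (X₁ q.1, u₁ q.1)) (fun q => (X₂ q.1, u₂ q.1)) p =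
      (modelBracket I X₁ X₂ p.1,
        modelDeriv I u₂ p.1 (X₁ p.1) - modelDeriv I u₁ p.1 (X₂ p.1)) := by
  rw [modelBracket_eq, modelBracket_eq, fderiv_chartVector_lift I hX₁ hu₁,
    fderiv_chartVector_lift I hX₂ hu₂]
  rfl

/-- As nothing depends on `t`, the component `u` of the field differentiates nothing; it enters only
through its own derivative, paired with `v`. -/
theorem modelLieDerivative_lift {X : M → E} {u v : M → EuclideanSpace ℝ (Fin h)}
    {α : M → E →L[ℝ] ℝ}
    (hX : ContDiffAt ℝ ∞ (chartVector I X p.1) (extChartAt I p.1 p.1))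
    (hu : ContMDiffAt I 𝓘(ℝ, EuclideanSpace ℝ (Fin h)) ∞ u p.1)
    (hα : ContDiffAt ℝ ∞ (chartCovector I α p.1) (extChartAt I p.1 p.1))
    (hv : ContMDiffAt I 𝓘(ℝ, EuclideanSpace ℝ (Fin h)) ∞ v p.1)
    (w : E × EuclideanSpace ℝ (Fin h)) :
    modelLieDerivative (prodModel I h) (fun q => (X q.1, u q.1))
        (fun q => prodCovector (α q.1) (v q.1)) p w =
      modelLieDerivative I X α p.1 w.1 + inner ℝ (v p.1) (modelDeriv I u p.1 w.1)
        + inner ℝ (modelDeriv I v p.1 (X p.1)) w.2 := by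
  rw [modelLieDerivative_eq, modelLieDerivative_eq, fderiv_chartCovector_lift I hα hv]
  simp only [add_apply, ContinuousLinearMap.comp_apply, fderiv_chartVector_lift I hX hu,
    prodCovector_apply]
  ring

theorem modelDeriv_halfPairing
    (hX₁ : ContDiffAt ℝ ∞ (chartVector I X₁ p.1) (extChartAt I p.1 p.1))
    (hX₂ : ContDiffAt ℝ ∞ (chartVector I X₂ p.1) (extChartAt I p.1 p.1))
    (hu₁ : ContMDiffAt I 𝓘(ℝ, EuclideanSpace ℝ (Fin h)) ∞ u₁ p.1)
    (hu₂ : ContMDiffAt I 𝓘(ℝ, EuclideanSpace ℝ (Fin h)) ∞ u₂ p.1)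
    (hα₁ : ContDiffAt ℝ ∞ (chartCovector I α₁ p.1) (extChartAt I p.1 p.1))
    (hα₂ : ContDiffAt ℝ ∞ (chartCovector I α₂ p.1) (extChartAt I p.1 p.1))
    (hv₁ : ContMDiffAt I 𝓘(ℝ, EuclideanSpace ℝ (Fin h)) ∞ v₁ p.1)
    (hv₂ : ContMDiffAt I 𝓘(ℝ, EuclideanSpace ℝ (Fin h)) ∞ v₂ p.1)
    (w : E × EuclideanSpace ℝ (Fin h)) :
    modelDeriv (prodModel I h) (fun q => (1 / 2 : ℝ) *
        (prodCovector (α₂ q.1) (v₂ q.1) (X₁ q.1, u₁ q.1)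
          - prodCovector (α₁ q.1) (v₁ q.1) (X₂ q.1, u₂ q.1))) p w =
      -((1 / 2 : ℝ) * modelDeriv I (fun y => α₁ y (X₂ y) - α₂ y (X₁ y)) p.1 w.1)
      + (1 / 2 : ℝ) *
        ((inner ℝ (v₂ p.1) (modelDeriv I u₁ p.1 w.1) + inner ℝ (u₁ p.1) (modelDeriv I v₂ p.1 w.1))
        - (inner ℝ (v₁ p.1) (modelDeriv I u₂ p.1 w.1)
          + inner ℝ (u₂ p.1) (modelDeriv I v₁ p.1 w.1))) := by
  have hA : ContMDiffAt I 𝓘(ℝ) ∞ (fun y => α₁ y (X₂ y) - α₂ y (X₁ y)) p.1 :=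
    (contMDiffAt_pairing I hX₂ hα₁).sub (contMDiffAt_pairing I hX₁ hα₂)
  have hinner {u v : M → EuclideanSpace ℝ (Fin h)}
      (hu : ContMDiffAt I 𝓘(ℝ, EuclideanSpace ℝ (Fin h)) ∞ u p.1)
      (hv : ContMDiffAt I 𝓘(ℝ, EuclideanSpace ℝ (Fin h)) ∞ v p.1) :
      ContMDiffAt I 𝓘(ℝ) ∞ (fun y => (inner ℝ (u y) (v y) : ℝ)) p.1 := by
    rw [contMDiffAt_iff_contDiffAt_chart] at hu hv ⊢
    exact hu.inner ℝ hv
  have hB : ContMDiffAt I 𝓘(ℝ) ∞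
      (fun y => (inner ℝ (v₂ y) (u₁ y) : ℝ) - inner ℝ (v₁ y) (u₂ y)) p.1 :=
    (hinner hv₂ hu₁).sub (hinner hv₁ hu₂)
  have hB' : modelDeriv I (fun y => (inner ℝ (v₂ y) (u₁ y) : ℝ) - inner ℝ (v₁ y) (u₂ y)) p.1 =
      modelDeriv I (fun y => (inner ℝ (v₂ y) (u₁ y) : ℝ)) p.1
        - modelDeriv I (fun y => (inner ℝ (v₁ y) (u₂ y) : ℝ)) p.1 :=
    mvfderiv_sub ((hinner hv₂ hu₁).mdifferentiableAt (by simp))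
      ((hinner hv₁ hu₂).mdifferentiableAt (by simp))
  have hsmul (c : ℝ) {f : M → ℝ} (hf : ContMDiffAt I 𝓘(ℝ) ∞ f p.1) :
      ContMDiffAt I 𝓘(ℝ) ∞ (fun y => c • f y) p.1 := by
    have hc : ContMDiffAt I 𝓘(ℝ) ∞ (fun _ : M => c) p.1 := contMDiffAt_const
    exact hc.smul hf
  have hS : ContMDiffAt I 𝓘(ℝ) ∞ (fun y => (-(1 / 2 : ℝ)) • (α₁ y (X₂ y) - α₂ y (X₁ y))
      + (1 / 2 : ℝ) • ((inner ℝ (v₂ y) (u₁ y) : ℝ) - inner ℝ (v₁ y) (u₂ y))) p.1 :=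
    (hsmul _ hA).add (hsmul _ hB)
  have hC : modelDeriv I (fun y => (-(1 / 2 : ℝ)) • (α₁ y (X₂ y) - α₂ y (X₁ y))
      + (1 / 2 : ℝ) • ((inner ℝ (v₂ y) (u₁ y) : ℝ) - inner ℝ (v₁ y) (u₂ y))) p.1 =
      (-(1 / 2 : ℝ)) • modelDeriv I (fun y => α₁ y (X₂ y) - α₂ y (X₁ y)) p.1
      + (1 / 2 : ℝ) •
        modelDeriv I (fun y => (inner ℝ (v₂ y) (u₁ y) : ℝ) - inner ℝ (v₁ y) (u₂ y)) p.1 := by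
    rw [modelDeriv_eq I (hA.mdifferentiableAt (by simp)),
      modelDeriv_eq I (hB.mdifferentiableAt (by simp)),
      modelDeriv_eq I (hS.mdifferentiableAt (by simp))]
    rw [contMDiffAt_iff_contDiffAt_chart] at hA hB
    exact (((hA.differentiableAt (by simp)).hasFDerivAt.const_smul (-(1 / 2 : ℝ))).add
      ((hB.differentiableAt (by simp)).hasFDerivAt.const_smul (1 / 2 : ℝ))).fderiv
  -- The half pairing on the product is a function on `M`: it splits into `-½(α₁(X₂) - α₂(X₁))` and
  -- `½(v₂ · u₁ - v₁ · u₂)`.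
  have hf : (fun q : M × EuclideanSpace ℝ (Fin h) => (1 / 2 : ℝ) *
        (prodCovector (α₂ q.1) (v₂ q.1) (X₁ q.1, u₁ q.1)
          - prodCovector (α₁ q.1) (v₁ q.1) (X₂ q.1, u₂ q.1))) =
      fun q => (fun y => (-(1 / 2 : ℝ)) • (α₁ y (X₂ y) - α₂ y (X₁ y))
      + (1 / 2 : ℝ) • ((inner ℝ (v₂ y) (u₁ y) : ℝ) - inner ℝ (v₁ y) (u₂ y))) q.1 := by
    funext q
    simp only [prodCovector_apply, smul_eq_mul]
    ring
  rw [hf, modelDeriv_comp_fst I hS, hC, hB']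
  simp only [add_apply, smul_apply, sub_apply, smul_eq_mul, modelDeriv_inner I hv₂ hu₁,
    modelDeriv_inner I hv₁ hu₂]
  ring

/-- The Lie derivatives give `v₂ · du₁ - v₁ · du₂`; subtracting `½ d(v₂ · u₁ - v₁ · u₂)` leaves
exactly the antisymmetric term with factor `½` of the stable bracket. Contracting `dt^a ∧ Ψ^a` gives
`u₁ · Ψ(X₂, ·) - u₂ · Ψ(X₁, ·)` on `M` and `Ψ(X₁, X₂)` as the `dt` component. -/
theorem courantBracket_lift
    (hX₁ : ContDiffAt ℝ ∞ (chartVector I X₁ p.1) (extChartAt I p.1 p.1))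
    (hX₂ : ContDiffAt ℝ ∞ (chartVector I X₂ p.1) (extChartAt I p.1 p.1))
    (hu₁ : ContMDiffAt I 𝓘(ℝ, EuclideanSpace ℝ (Fin h)) ∞ u₁ p.1)
    (hu₂ : ContMDiffAt I 𝓘(ℝ, EuclideanSpace ℝ (Fin h)) ∞ u₂ p.1)
    (hα₁ : ContDiffAt ℝ ∞ (chartCovector I α₁ p.1) (extChartAt I p.1 p.1))
    (hα₂ : ContDiffAt ℝ ∞ (chartCovector I α₂ p.1) (extChartAt I p.1 p.1))
    (hv₁ : ContMDiffAt I 𝓘(ℝ, EuclideanSpace ℝ (Fin h)) ∞ v₁ p.1)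
    (hv₂ : ContMDiffAt I 𝓘(ℝ, EuclideanSpace ℝ (Fin h)) ∞ v₂ p.1) :
    courantBracket (prodModel I h) (twistForm I Φ Ψ)
      (fun q => bigMk (prodModel I h) q (X₁ q.1, u₁ q.1) (prodCovector (α₁ q.1) (v₁ q.1)))
      (fun q => bigMk (prodModel I h) q (X₂ q.1, u₂ q.1) (prodCovector (α₂ q.1) (v₂ q.1))) p =
    liftAt I p (stableBracket I Φ Ψ (fun y => stableMk I y (X₁ y) (u₁ y) (α₁ y) (v₁ y))
        (fun y => stableMk I y (X₂ y) (u₂ y) (α₂ y) (v₂ y)) p.1) := by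
  rw [stableBracket_stableMk, liftAt_stableMk, courantBracket_bigMk,
    modelBracket_lift I hX₁ hX₂ hu₁ hu₂]
  refine congrArg (bigMk (prodModel I h) p _) (ContinuousLinearMap.ext fun w => ?_)
  rw [add_apply, sub_apply, modelDeriv_halfPairing I hX₁ hX₂ hu₁ hu₂ hα₁ hα₂ hv₁ hv₂]
  simp only [add_apply, sub_apply, smul_apply, smul_eq_mul, prodCovector_apply, sum_apply,
    ContinuousLinearMap.comp_apply, innerSL_apply_apply,
    modelLieDerivative_lift I hX₁ hu₁ hα₂ hv₂, modelLieDerivative_lift I hX₂ hu₂ hα₁ hv₁,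
    twistForm_apply, inner_add_left, inner_sub_left, Finset.sum_add_distrib, Finset.sum_sub_distrib]
  have hin : inner ℝ (WithLp.toLp 2
      fun a => modelContract₂ I (Ψ a) p.1 (X₁ p.1) (X₂ p.1)) w.2 =
      ∑ i, w.2 i * modelContract₂ I (Ψ i) p.1 (X₁ p.1) (X₂ p.1) := by
    simp [PiLp.inner_apply]
  rw [hin]
  ring

end Bracket

/-! ### Maximal isotropic subspaces of a neutral space -/

section Neutral

/-- Adjoining a null vector orthogonal to `W` keeps the subspace isotropic, so maximality forbids a
proper enlargement. -/
theorem IsMaximalIsotropic.mem_of_null {V : Type*} [AddCommGroup V] [Module ℝ V]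
    {B : LinearMap.BilinForm ℝ V} (hB : ∀ a b, B a b = B b a) {W : Submodule ℝ V}
    (hW : IsMaximalIsotropic (fun a b => B a b) W) {z : V} (hz : ∀ a ∈ W, B z a = 0)
    (hzz : B z z = 0) : z ∈ W := by
  have h : W ⊔ Submodule.span ℝ {z} ≤ W := by
    refine hW.2 ?_ le_sup_left
    intro a ha b hb
    obtain ⟨a', ha', _, hs, rfl⟩ := Submodule.mem_sup.1 ha
    obtain ⟨s, rfl⟩ := Submodule.mem_span_singleton.1 hs
    obtain ⟨b', hb', _, ht, rfl⟩ := Submodule.mem_sup.1 hb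
    obtain ⟨t, rfl⟩ := Submodule.mem_span_singleton.1 ht
    have h1 : B a' b' = 0 := hW.1 a' ha' b' hb'
    have h2 : B a' z = 0 := (hB a' z).trans (hz a' ha')
    simp [h1, h2, hz b' hb', hzz]
  exact h (Submodule.mem_sup_right (Submodule.mem_span_singleton_self z))

theorem exists_mem_inf_ne_zero {V : Type*} [AddCommGroup V] [Module ℝ V] [FiniteDimensional ℝ V]
    {P Q : Submodule ℝ V}
    (h : Module.finrank ℝ V < Module.finrank ℝ P + Module.finrank ℝ Q) :
    ∃ z ∈ P, z ∈ Q ∧ z ≠ 0 := by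
  by_contra! hc
  have h0 : P ⊓ Q = ⊥ := by
    rw [eq_bot_iff]
    rintro z ⟨hP, hQ⟩
    exact (Submodule.mem_bot ℝ).2 (hc z hP hQ)
  have h1 := Submodule.finrank_sup_add_finrank_inf_eq P Q
  rw [h0, finrank_bot] at h1
  have h2 := Submodule.finrank_le (P ⊔ Q)
  omega

/-- Suppose `B w w > 0`. Then `W + ⟨w⟩` is positive semidefinite, so it meets `N` trivially and `dim
W < dim N`. Hence the orthogonal of `W` is large enough to meet `N` in some `b ≠ 0`, with `B b b <
0`. The span of `w` and `b` contains a null vector orthogonal to `W`, which lies in `W` and is thus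
orthogonal to `w` and `b`; this contradicts nondegeneracy on that span. -/
theorem IsMaximalIsotropic.nonpos_of_orthogonal {V : Type*} [AddCommGroup V] [Module ℝ V]
    [FiniteDimensional ℝ V] {B : LinearMap.BilinForm ℝ V} (hB : ∀ a b, B a b = B b a)
    {N : Submodule ℝ V} (hN : ∀ a ∈ N, a ≠ 0 → B a a < 0)
    (hN' : 2 * Module.finrank ℝ N = Module.finrank ℝ V) {W : Submodule ℝ V}
    (hW : IsMaximalIsotropic (fun a b => B a b) W) {w : V} (hw : ∀ a ∈ W, B w a = 0) :
    B w w ≤ 0 := by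
  by_contra! hpos
  have hwW : w ∉ W := fun hmem => hpos.ne' (hw w hmem)
  have hlt : Module.finrank ℝ W < Module.finrank ℝ ↥(W ⊔ Submodule.span ℝ {w}) := by
    refine Submodule.finrank_lt_finrank_of_lt (lt_of_le_of_ne le_sup_left fun he => hwW ?_)
    rw [he]
    exact Submodule.mem_sup_right (Submodule.mem_span_singleton_self w)
  have hle : Module.finrank ℝ ↥(W ⊔ Submodule.span ℝ {w}) + Module.finrank ℝ N
      ≤ Module.finrank ℝ V := by
    by_contra! hc
    obtain ⟨z, hz, hzN, hz0⟩ := exists_mem_inf_ne_zero hc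
    have hneg := hN z hzN hz0
    obtain ⟨a, ha, _, hs, rfl⟩ := Submodule.mem_sup.1 hz
    obtain ⟨s, rfl⟩ := Submodule.mem_span_singleton.1 hs
    have h1 : B a a = 0 := hW.1 a ha a ha
    have h2 : B a w = 0 := (hB a w).trans (hw a ha)
    simp only [map_add, map_smul, LinearMap.add_apply, LinearMap.smul_apply, smul_eq_mul, h1, h2,
      hw a ha] at hneg
    nlinarith [mul_nonneg (mul_self_nonneg s) hpos.le]
  -- The kernel of `B` followed by restriction to `W` is the orthogonal of `W`; its codimension is
  -- at most `dim W`, whether or not `B` is nondegenerate.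
  have hker : Module.finrank ℝ V < Module.finrank ℝ (LinearMap.ker (W.subtype.dualMap ∘ₗ B))
      + Module.finrank ℝ N := by
    have h1 := LinearMap.finrank_range_add_finrank_ker (W.subtype.dualMap ∘ₗ B)
    have h2 := Submodule.finrank_le (LinearMap.range (W.subtype.dualMap ∘ₗ B))
    rw [Subspace.dual_finrank_eq] at h2
    omega
  obtain ⟨b, hb, hbN, hb0⟩ := exists_mem_inf_ne_zero hker
  have hbneg := hN b hbN hb0
  have hbW : ∀ a ∈ W, B b a = 0 := fun a ha =>
    congrArg (fun f : Module.Dual ℝ W => f ⟨a, ha⟩) (LinearMap.mem_ker.1 hb)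
  have hdisc : 0 ≤ B w b ^ 2 - B w w * B b b := by nlinarith [sq_nonneg (B w b)]
  -- The scalar `c` below is a root of the quadratic `B (w + c • b) (w + c • b)`, whose discriminant
  -- is nonnegative because `B w w` and `B b b` have opposite signs.
  set r := Real.sqrt (B w b ^ 2 - B w w * B b b) with hr
  have hr2 : r ^ 2 = B w b ^ 2 - B w w * B b b := Real.sq_sqrt hdisc
  set c := (-(B w b) + r) / B b b with hc
  have hcb : c * B b b = -(B w b) + r := div_mul_cancel₀ _ hbneg.ne
  have hbw : B b w = B w b := hB b w
  have hzz : B (w + c • b) (w + c • b) = 0 := by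
    simp only [map_add, map_smul, LinearMap.add_apply, LinearMap.smul_apply, smul_eq_mul, hbw]
    have : B b b * (B w w + c * B w b + c * (B w b + c * B b b)) = 0 := by
      have : B b b * (B w w + c * B w b + c * (B w b + c * B b b)) =
        B b b * B w w + 2 * (c * B b b) * B w b + (c * B b b) ^ 2 := by ring
      rw [this, hcb]
      nlinarith
    have h2 := (mul_eq_zero.1 this).resolve_left hbneg.ne
    linarith
  have hzW : w + c • b ∈ W := by
    refine hW.mem_of_null hB (fun a ha => ?_) hzz
    simp [hw a ha, hbW a ha]
  have e1 := hw _ hzW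
  have e2 := hbW _ hzW
  simp only [map_add, map_smul, smul_eq_mul, hbw] at e1 e2
  have e3 : B w w * B b b = B w b ^ 2 := by
    linear_combination B b b * e1 - B w b * e2
  nlinarith [sq_nonneg (B w b), mul_neg_of_pos_of_neg hpos hbneg]

/-- In a space with a neutral metric, a maximal isotropic subspace contains its orthogonal. -/
theorem IsMaximalIsotropic.mem_of_orthogonal {V : Type*} [AddCommGroup V] [Module ℝ V]
    [FiniteDimensional ℝ V] {B : LinearMap.BilinForm ℝ V} (hB : ∀ a b, B a b = B b a)
    {P N : Submodule ℝ V} (hP : ∀ a ∈ P, a ≠ 0 → 0 < B a a)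
    (hP' : 2 * Module.finrank ℝ P = Module.finrank ℝ V) (hN : ∀ a ∈ N, a ≠ 0 → B a a < 0)
    (hN' : 2 * Module.finrank ℝ N = Module.finrank ℝ V) {W : Submodule ℝ V}
    (hW : IsMaximalIsotropic (fun a b => B a b) W) {w : V} (hw : ∀ a ∈ W, B w a = 0) :
    w ∈ W := by
  refine hW.mem_of_null hB hw (le_antisymm (hW.nonpos_of_orthogonal hB hN hN' hw) ?_)
  -- The forms `B` and `-B` have the same isotropic subspaces, so the one-sided estimate for `-B`,
  -- with `P` as negative subspace, gives the opposite inequality.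
  have hW' : IsMaximalIsotropic (fun a b => (-B) a b) W := by
    simpa only [IsMaximalIsotropic, LinearMap.neg_apply, neg_eq_zero] using hW
  have h := hW'.nonpos_of_orthogonal (fun a b => by simp [hB a b])
    (N := P) (fun a ha h0 => by simpa using hP a ha h0) hP' (fun a ha => by simpa using hw a ha)
  simpa using h

/-! ### The model neutral space `E ⊕ E*`. -/

variable {E : Type*} [NormedAddCommGroup E] [NormedSpace ℝ E]

/-- The neutral metric of `E ⊕ E*`. -/
noncomputable def neutralForm (E : Type*) [NormedAddCommGroup E] [NormedSpace ℝ E] :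
    LinearMap.BilinForm ℝ (E × (E →L[ℝ] ℝ)) :=
  LinearMap.mk₂ ℝ (fun a b => (1 / 2) * (b.2 a.1 + a.2 b.1))
    (fun a b c => by simp; ring) (fun s a b => by simp; ring)
    (fun a b c => by simp; ring) (fun s a b => by simp; ring)

theorem neutralForm_apply (a b : E × (E →L[ℝ] ℝ)) :
    neutralForm E a b = (1 / 2) * (b.2 a.1 + a.2 b.1) := rfl

/-- The graph of `s` times a Euclidean inner product of `E`. -/
noncomputable def euclideanGraph (E : Type*) [NormedAddCommGroup E] [NormedSpace ℝ E]
    [FiniteDimensional ℝ E] (s : ℝ) : E →ₗ[ℝ] E × (E →L[ℝ] ℝ) where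
  toFun v := (v, s • (innerSL ℝ (toEuclidean v)).comp
    ((toEuclidean : E ≃L[ℝ] _) : E →L[ℝ] EuclideanSpace ℝ (Fin (Module.finrank ℝ E))))
  map_add' v w := by
    refine Prod.ext rfl (ContinuousLinearMap.ext fun z => ?_)
    simp
  map_smul' c v := by
    refine Prod.ext rfl (ContinuousLinearMap.ext fun z => ?_)
    simp; ring

theorem neutralForm_euclideanGraph [FiniteDimensional ℝ E] (s : ℝ) (v : E) :
    neutralForm E (euclideanGraph E s v) (euclideanGraph E s v) = s * ‖toEuclidean v‖ ^ 2 := by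
  rw [neutralForm_apply, ← real_inner_self_eq_norm_sq]
  simp [euclideanGraph]
  ring

theorem finrank_range_euclideanGraph [FiniteDimensional ℝ E] (s : ℝ) :
    2 * Module.finrank ℝ (LinearMap.range (euclideanGraph E s))
      = Module.finrank ℝ (E × (E →L[ℝ] ℝ)) := by
  rw [LinearMap.finrank_range_of_inj (fun v w hvw => congrArg Prod.fst hvw), Module.finrank_prod,
    ← (LinearMap.toContinuousLinearMap (𝕜 := ℝ) (E := E) (F' := ℝ)).finrank_eq]
  have : Module.finrank ℝ (E →ₗ[ℝ] ℝ) = Module.finrank ℝ E := Subspace.dual_finrank_eq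
  omega

/-- The graphs of plus and minus a Euclidean inner product are definite of opposite signs and of
half dimension, which exhibits the signature as neutral. -/
theorem IsMaximalIsotropic.mem_of_neutralForm_eq_zero [FiniteDimensional ℝ E]
    {W : Submodule ℝ (E × (E →L[ℝ] ℝ))}
    (hW : IsMaximalIsotropic (fun a b => neutralForm E a b) W) {w : E × (E →L[ℝ] ℝ)}
    (hw : ∀ a ∈ W, neutralForm E w a = 0) : w ∈ W := by
  have key (v : E) (s : ℝ) (h0 : euclideanGraph E s v ≠ 0) : 0 < ‖toEuclidean v‖ ^ 2 := by
    have hv : v ≠ 0 := fun h => h0 (by rw [h, map_zero])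
    have : (toEuclidean v : EuclideanSpace ℝ (Fin (Module.finrank ℝ E))) ≠ 0 := by simpa using hv
    positivity
  refine hW.mem_of_orthogonal (P := LinearMap.range (euclideanGraph E 1))
    (N := LinearMap.range (euclideanGraph E (-1)))
    (fun a b => by rw [neutralForm_apply, neutralForm_apply]; ring) ?_
    (finrank_range_euclideanGraph 1) ?_ (finrank_range_euclideanGraph (-1)) hw
  · rintro _ ⟨v, rfl⟩ h0
    rw [neutralForm_euclideanGraph]
    linarith [key v _ h0]
  · rintro _ ⟨v, rfl⟩ h0
    rw [neutralForm_euclideanGraph]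
    linarith [key v _ h0]

theorem isMaximalIsotropic_map_iff {V V' : Type*} [AddCommGroup V] [Module ℝ V] [AddCommGroup V']
    [Module ℝ V'] {G : V → V → ℝ} {G' : V' → V' → ℝ} (e : V ≃ₗ[ℝ] V')
    (hG : ∀ a b, G' (e a) (e b) = G a b) (W : Submodule ℝ V) :
    IsMaximalIsotropic G' (W.map (e : V →ₗ[ℝ] V')) ↔ IsMaximalIsotropic G W := by
  have h1 (W : Submodule ℝ V) : (∀ a ∈ W.map (e : V →ₗ[ℝ] V'), ∀ b ∈ W.map (e : V →ₗ[ℝ] V'),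
      G' a b = 0) ↔ ∀ a ∈ W, ∀ b ∈ W, G a b = 0 := by
    constructor
    · intro H a ha b hb
      exact (hG a b).symm.trans
        (H _ (Submodule.mem_map_of_mem ha) _ (Submodule.mem_map_of_mem hb))
    · rintro H _ ⟨a, ha, rfl⟩ _ ⟨b, hb, rfl⟩
      exact (hG a b).trans (H a ha b hb)
  constructor
  · intro hW
    refine ⟨(h1 W).1 hW.1, fun U hU hWU => ?_⟩
    have := hW.2 ((h1 U).2 hU) (Submodule.map_mono hWU)
    exact (Submodule.map_le_map_iff_of_injective e.injective U W).1 this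
  · intro hW
    refine ⟨(h1 W).2 hW.1, fun U hU hWU => ?_⟩
    obtain ⟨U, rfl⟩ : ∃ U' : Submodule ℝ V, U'.map (e : V →ₗ[ℝ] V') = U :=
      ⟨U.comap (e : V →ₗ[ℝ] V'), Submodule.map_comap_eq_of_surjective e.surjective U⟩
    exact Submodule.map_mono (hW.2 ((h1 U).1 hU)
      ((Submodule.map_le_map_iff_of_injective e.injective W U).1 hWU))

end Neutral

section Lift

variable {E : Type*} [NormedAddCommGroup E] [NormedSpace ℝ E]
  {H : Type*} [TopologicalSpace H] (I : ModelWithCorners ℝ E H)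
  {M : Type*} [TopologicalSpace M] [ChartedSpace H M] {h : ℕ}

/-! ### Smooth sections -/

/-- Smoothness at a point, in charts, of the section `X ⊕ α` of the big tangent bundle. -/
def ChartSmoothAt (X : M → E) (α : M → E →L[ℝ] ℝ) (x : M) : Prop :=
  ContDiffAt ℝ ∞ (chartVector I X x) (extChartAt I x x) ∧
    ContDiffAt ℝ ∞ (chartCovector I α x) (extChartAt I x x)

theorem contMDiffOn_iff_of_isOpen {E' H' M' : Type*} [NormedAddCommGroup E'] [NormedSpace ℝ E']
    [TopologicalSpace H'] {I' : ModelWithCorners ℝ E' H'} [TopologicalSpace M']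
    [ChartedSpace H' M'] {U : Set M} (hU : IsOpen U) {f : M → M'} :
    ContMDiffOn I I' ∞ f U ↔ ∀ x ∈ U, ContMDiffAt I I' ∞ f x :=
  ⟨fun hf _ hx => hf.contMDiffAt (hU.mem_nhds hx), fun hf x hx => (hf x hx).contMDiffWithinAt⟩

theorem smoothBigSectionOn_iff [I.Boundaryless] [IsManifold I ∞ M] {U : Set M} (hU : IsOpen U)
    {s : Π x : M, BigTangent I x} :
    SmoothBigSectionOn I U s ↔ ∀ x ∈ U, ChartSmoothAt I (fun y => (s y).1) (fun y => (s y).2) x := by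
  rw [SmoothBigSectionOn, SmoothVectorOn, SmoothCovectorOn, contMDiffOn_iff_of_isOpen I hU,
    contMDiffOn_iff_of_isOpen I hU,    ← forall₂_and]
  exact forall₂_congr fun x _ => and_congr (contMDiffAt_vector_iff I) (contMDiffAt_covector_iff I)

theorem smoothStableSectionOn_iff [I.Boundaryless] [IsManifold I ∞ M] {U : Set M} (hU : IsOpen U)
    {s : Π x : M, StableBigTangent I h x} :
    SmoothStableSectionOn I h U s ↔ ∀ x ∈ U,
      ChartSmoothAt I (fun y => (s y).1.1) (fun y => (s y).2.1) x ∧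
      ContMDiffAt I 𝓘(ℝ, EuclideanSpace ℝ (Fin h)) ∞ (fun y => (s y).1.2) x ∧
      ContMDiffAt I 𝓘(ℝ, EuclideanSpace ℝ (Fin h)) ∞ (fun y => (s y).2.2) x := by
  rw [SmoothStableSectionOn, SmoothVectorOn, SmoothCovectorOn,
    contMDiffOn_iff_of_isOpen I hU, contMDiffOn_iff_of_isOpen I hU,
    contMDiffOn_iff_of_isOpen I hU, contMDiffOn_iff_of_isOpen I hU]
  constructor
  · rintro ⟨h1, h2, h3, h4⟩ x hx
    exact ⟨⟨(contMDiffAt_vector_iff I).1 (h1 x hx), (contMDiffAt_covector_iff I).1 (h3 x hx)⟩,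
      h2 x hx, h4 x hx⟩
  · intro H
    exact ⟨fun x hx => (contMDiffAt_vector_iff I).2 (H x hx).1.1, fun x hx => (H x hx).2.1,
      fun x hx => (contMDiffAt_covector_iff I).2 (H x hx).1.2, fun x hx => (H x hx).2.2⟩

theorem liftSection_apply (s : Π x : M, StableBigTangent I h x)
    (p : M × EuclideanSpace ℝ (Fin h)) :
    liftSection I s p = bigMk (prodModel I h) p ((s p.1).1.1, (s p.1).1.2)
      (prodCovector (s p.1).2.1 (s p.1).2.2) :=
  liftAt_stableMk I p (s p.1).1.1 (s p.1).1.2 (s p.1).2.1 (s p.1).2.2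

theorem SmoothStableSectionOn.liftSection [I.Boundaryless] [IsManifold I ∞ M] {U : Set M}
    (hU : IsOpen U) {s : Π x : M, StableBigTangent I h x} (hs : SmoothStableSectionOn I h U s) :
    SmoothBigSectionOn (prodModel I h) (Prod.fst ⁻¹' U) (liftSection I s) := by
  rw [smoothStableSectionOn_iff I hU] at hs
  rw [smoothBigSectionOn_iff _ (hU.preimage continuous_fst)]
  intro p hp
  obtain ⟨⟨h1, h2⟩, h3, h4⟩ := hs p.1 hp
  rw [contMDiffAt_iff_contDiffAt_chart] at h3 h4
  refine ⟨contDiffAt_chartVector_lift I h1 h3, ?_⟩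
  obtain ⟨α, hα⟩ : ∃ α : M → E →L[ℝ] ℝ, α = fun y => (s y).2.1 := ⟨_, rfl⟩
  obtain ⟨v, hv⟩ : ∃ v : M → EuclideanSpace ℝ (Fin h), v = fun y => (s y).2.2 := ⟨_, rfl⟩
  -- The lifted covector field is the field of `prodCovector`s to which the chart lemma applies.
  have e : (fun q => (StableDirac.liftSection I s q).2 :
      M × EuclideanSpace ℝ (Fin h) → (E × EuclideanSpace ℝ (Fin h)) →L[ℝ] ℝ) =
      fun q => prodCovector (α q.1) (v q.1) := by
    subst hα hv
    exact funext fun q => congrArg Prod.snd (liftSection_apply I s q)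
  rw [← hα] at h2
  rw [← hv] at h4
  have h5 := contDiffAt_chartCovector_lift I h2 h4
  rw [← e] at h5
  exact h5

/-- The vector of `ℝ^h` dual to the restriction of a covector to `ℝ^h`. -/
noncomputable def euclideanPart (β : (E × EuclideanSpace ℝ (Fin h)) →L[ℝ] ℝ) :
    EuclideanSpace ℝ (Fin h) :=
  ∑ a, β (0, EuclideanSpace.basisFun (Fin h) ℝ a) • EuclideanSpace.basisFun (Fin h) ℝ a

theorem inner_euclideanPart (β : (E × EuclideanSpace ℝ (Fin h)) →L[ℝ] ℝ)
    (w : EuclideanSpace ℝ (Fin h)) : inner ℝ (euclideanPart β) w = β (0, w) := by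
  have h1 := (EuclideanSpace.basisFun (Fin h) ℝ).sum_repr' w
  have h2 : β (0, w) = β.comp (ContinuousLinearMap.inr ℝ E (EuclideanSpace ℝ (Fin h))) w := rfl
  rw [h2]
  conv_rhs => rw [← h1]
  rw [map_sum, euclideanPart, sum_inner]
  refine Finset.sum_congr rfl fun a _ => ?_
  rw [real_inner_smul_left, map_smul, smul_eq_mul, mul_comm]
  rfl

theorem prodCovector_injective {l l' : E →L[ℝ] ℝ} {w w' : EuclideanSpace ℝ (Fin h)}
    (H : prodCovector l w = prodCovector l' w') : l = l' ∧ w = w' := by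
  have h3 (z : E × EuclideanSpace ℝ (Fin h)) :
      prodCovector l w z = prodCovector l' w' z := by rw [H]
  refine ⟨ContinuousLinearMap.ext fun z => ?_, ext_inner_right ℝ fun z => ?_⟩
  · simpa [prodCovector_apply] using h3 (z, 0)
  · simpa [prodCovector_apply] using h3 (0, z)

theorem prodCovector_euclideanPart (β : (E × EuclideanSpace ℝ (Fin h)) →L[ℝ] ℝ) :
    prodCovector (β.comp (ContinuousLinearMap.inl ℝ E _)) (euclideanPart β) = β := by
  ext w
  · simp [prodCovector_apply]
  · simp only [ContinuousLinearMap.comp_apply, prodCovector_apply, inner_euclideanPart,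
      ContinuousLinearMap.inr_apply, map_zero, zero_add]

/-- The inverse of `liftAt`. -/
noncomputable def unliftAt (p : M × EuclideanSpace ℝ (Fin h))
    (v : E × EuclideanSpace ℝ (Fin h)) (β : (E × EuclideanSpace ℝ (Fin h)) →L[ℝ] ℝ) :
    StableBigTangent I h p.1 :=
  stableMk I p.1 v.1 v.2 (β.comp (ContinuousLinearMap.inl ℝ E _)) (euclideanPart β)

theorem liftAt_unliftAt (p : M × EuclideanSpace ℝ (Fin h)) (v : E × EuclideanSpace ℝ (Fin h))
    (β : (E × EuclideanSpace ℝ (Fin h)) →L[ℝ] ℝ) :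
    liftAt I p (unliftAt I p v β) = bigMk (prodModel I h) p v β := by
  rw [unliftAt, liftAt_stableMk, prodCovector_euclideanPart]

theorem liftAt_injective (p : M × EuclideanSpace ℝ (Fin h)) :
    Function.Injective (liftAt I p : StableBigTangent I h p.1 →ₗ[ℝ] _) := by
  intro a b hab
  have h1 : bigMk (prodModel I h) p (a.1.1, a.1.2) (prodCovector a.2.1 a.2.2)
    = bigMk (prodModel I h) p (b.1.1, b.1.2) (prodCovector b.2.1 b.2.2) :=
    (liftAt_stableMk I p a.1.1 a.1.2 a.2.1 a.2.2).symm.trans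
      (hab.trans (liftAt_stableMk I p b.1.1 b.1.2 b.2.1 b.2.2))
  obtain ⟨h2, h3⟩ := prodCovector_injective (congrArg Prod.snd h1)
  have h0 := congrArg Prod.fst h1
  exact Prod.ext h0 (Prod.ext h2 h3)

/-- `liftAt` as a linear equivalence. -/
noncomputable def liftEquiv (p : M × EuclideanSpace ℝ (Fin h)) :
    StableBigTangent I h p.1 ≃ₗ[ℝ] BigTangent (prodModel I h) p :=
  LinearEquiv.ofBijective (liftAt I p)
    ⟨liftAt_injective I p, fun b => ⟨unliftAt I p b.1 b.2, liftAt_unliftAt I p b.1 b.2⟩⟩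

theorem bigMetric_liftAt_stableMk (p : M × EuclideanSpace ℝ (Fin h)) (v v' : E)
    (u u' : EuclideanSpace ℝ (Fin h)) (l l' : E →L[ℝ] ℝ) (w w' : EuclideanSpace ℝ (Fin h)) :
    bigMetric (prodModel I h) p (liftAt I p (stableMk I p.1 v u l w))
      (liftAt I p (stableMk I p.1 v' u' l' w')) =
    (1 / 2) * (l' v + l v' + inner ℝ u w' + inner ℝ u' w) := by
  rw [liftAt_stableMk, liftAt_stableMk, bigMetric_bigMk, prodCovector_apply, prodCovector_apply,
    real_inner_comm u w', real_inner_comm u' w]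
  ring

theorem bigMetric_liftAt (p : M × EuclideanSpace ℝ (Fin h)) (a b : StableBigTangent I h p.1) :
    bigMetric (prodModel I h) p (liftAt I p a) (liftAt I p b) = stableMetric I h p.1 a b :=
  bigMetric_liftAt_stableMk I p a.1.1 b.1.1 a.1.2 b.1.2 a.2.1 b.2.1 a.2.2 b.2.2

/-- The restriction to `t = 0` of a section of the big tangent bundle of `M × ℝ^h`. -/
noncomputable def restrictSection
    (s : Π p : M × EuclideanSpace ℝ (Fin h), BigTangent (prodModel I h) p) (x : M) :
    StableBigTangent I h x :=
  unliftAt I (x, (0 : EuclideanSpace ℝ (Fin h))) (s (x, 0)).1 (s (x, 0)).2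

theorem liftAt_restrictSection
    (s : Π p : M × EuclideanSpace ℝ (Fin h), BigTangent (prodModel I h) p) (x : M) :
    liftAt I (x, 0) (restrictSection I s x) = s (x, 0) :=
  liftAt_unliftAt I (x, 0) (s (x, 0)).1 (s (x, 0)).2

/-- In a product chart the restriction is composition with the slice `y ↦ (y, 0)`. The four
components are then extracted by fixed linear operations, which commute with the frame because it is
a product with the identity of `ℝ^h`. -/
theorem SmoothBigSectionOn.restrictSection [I.Boundaryless] [IsManifold I ∞ M]
    {U : Set (M × EuclideanSpace ℝ (Fin h))} (hU : IsOpen U)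
    {s : Π p : M × EuclideanSpace ℝ (Fin h), BigTangent (prodModel I h) p}
    (hs : SmoothBigSectionOn (prodModel I h) U s) :
    SmoothStableSectionOn I h ((fun x => (x, 0)) ⁻¹' U) (restrictSection I s) := by
  rw [smoothBigSectionOn_iff _ hU] at hs
  rw [smoothStableSectionOn_iff I (hU.preimage (by fun_prop))]
  intro x hx
  obtain ⟨h1, h2⟩ := hs (x, 0) hx
  rw [extChartAt_prodModel] at h1 h2
  set Y : M × EuclideanSpace ℝ (Fin h) → E × EuclideanSpace ℝ (Fin h) := fun q => (s q).1 with hY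
  set β : M × EuclideanSpace ℝ (Fin h) → (E × EuclideanSpace ℝ (Fin h)) →L[ℝ] ℝ :=
    fun q => (s q).2 with hβ
  have hi : ContDiffAt ℝ ∞ (fun y : E => (y, (0 : EuclideanSpace ℝ (Fin h))))
      (extChartAt I x x) := contDiffAt_id.prodMk contDiffAt_const
  have h1' : ContDiffAt ℝ ∞ (fun y : E => chartVector (prodModel I h) Y (x, 0) (y, 0))
      (extChartAt I x x) := h1.comp (extChartAt I x x) hi
  have h2' : ContDiffAt ℝ ∞ (fun y : E => chartCovector (prodModel I h) β (x, 0) (y, 0))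
      (extChartAt I x x) := h2.comp (extChartAt I x x) hi
  have e1 {y : E} (hy : y ∈ (extChartAt I x).target) :=
    chartVector_prodModel I Y (x, 0) (y := (y, 0)) hy
  have e2 {y : E} (hy : y ∈ (extChartAt I x).target) :=
    chartCovector_prodModel I β (x, 0) (y := (y, 0)) hy
  refine ⟨⟨?_, ?_⟩, ?_, ?_⟩
  · refine (contDiffAt_congr_of_eqOn_target I fun y hy => ?_).1 h1'.fst
    exact congrArg Prod.fst (e1 hy)
  · have h3 : ContDiffAt ℝ ∞ (fun y : E => (chartCovector (prodModel I h) β (x, 0) (y, 0)).comp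
        (ContinuousLinearMap.inl ℝ E (EuclideanSpace ℝ (Fin h)))) (extChartAt I x x) :=
      h2'.clm_comp contDiffAt_const
    refine (contDiffAt_congr_of_eqOn_target I fun y hy => ?_).1 h3
    ext v
    have := congrArg (fun A : (E × EuclideanSpace ℝ (Fin h)) →L[ℝ] ℝ => A (v, 0)) (e2 hy)
    exact this
  · rw [contMDiffAt_iff_contDiffAt_chart]
    refine (contDiffAt_congr_of_eqOn_target I fun y hy => ?_).1 h1'.snd
    have := congrArg (fun z : E × EuclideanSpace ℝ (Fin h) => z.2) (e1 hy)
    exact this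
  · rw [contMDiffAt_iff_contDiffAt_chart]
    have h3 : ContDiffAt ℝ ∞ (fun y : E =>
        euclideanPart (chartCovector (prodModel I h) β (x, 0) (y, 0))) (extChartAt I x x) :=
      ContDiffAt.sum fun a _ => (h2'.clm_apply contDiffAt_const).smul contDiffAt_const
    refine (contDiffAt_congr_of_eqOn_target I fun y hy => ?_).1 h3
    refine Finset.sum_congr rfl fun a _ => ?_
    refine congrArg (fun c : ℝ => c • EuclideanSpace.basisFun (Fin h) ℝ a) ?_
    have := congrArg (fun A : (E × EuclideanSpace ℝ (Fin h)) →L[ℝ] ℝ =>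
      A (0, EuclideanSpace.basisFun (Fin h) ℝ a)) (e2 hy)
    -- The frame fixes vectors tangent to `ℝ^h`, so the `dt` coefficients in the chart are the
    -- original ones.
    have hz : (chartFrame I x y).prodMap (ContinuousLinearMap.id ℝ (EuclideanSpace ℝ (Fin h)))
        (0, EuclideanSpace.basisFun (Fin h) ℝ a) = (0, EuclideanSpace.basisFun (Fin h) ℝ a) :=
      Prod.ext (map_zero (chartFrame I x y)) rfl
    exact this.trans (congrArg (β ((extChartAt I x).symm y, 0)) hz)

end Lift

section Correspondence

variable {E : Type*} [NormedAddCommGroup E] [NormedSpace ℝ E]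
  {H : Type*} [TopologicalSpace H] (I : ModelWithCorners ℝ E H)
  {M : Type*} [TopologicalSpace M] [ChartedSpace H M] {h : ℕ}

/-! ### The correspondence `L ↦ L̃` -/

theorem restrictZero_extend (L : Π x : M, Submodule ℝ (StableBigTangent I h x)) :
    restrictZero I (extend I L) = L := by
  funext x
  exact Submodule.comap_map_eq_of_injective (liftAt_injective I (x, 0)) (L x)

theorem bigMk_mem_extend_iff (L : Π x : M, Submodule ℝ (StableBigTangent I h x))
    (p : M × EuclideanSpace ℝ (Fin h)) (v : E × EuclideanSpace ℝ (Fin h))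
    (β : (E × EuclideanSpace ℝ (Fin h)) →L[ℝ] ℝ) :
    bigMk (prodModel I h) p v β ∈ extend I L p ↔ unliftAt I p v β ∈ L p.1 := by
  rw [← liftAt_unliftAt]
  exact (liftAt_injective I p).mem_set_image

theorem hasMFDerivAt_translation (s : EuclideanSpace ℝ (Fin h)) (p : M × EuclideanSpace ℝ (Fin h)) :
    HasMFDerivAt (prodModel I h) (prodModel I h) (translation s) p
      (ContinuousLinearMap.id ℝ (E × EuclideanSpace ℝ (Fin h))) := by
  have h1 : HasMFDerivAt 𝓘(ℝ, EuclideanSpace ℝ (Fin h)) 𝓘(ℝ, EuclideanSpace ℝ (Fin h))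
      (fun t => t + s) p.2 (ContinuousLinearMap.id ℝ _) :=
    ((hasFDerivAt_id p.2).add_const s).hasMFDerivAt
  exact (hasMFDerivAt_fst (I := I) p).prodMk (h1.comp p (hasMFDerivAt_snd (I := I) p))

/-- The differential of a translation is the identity of `E × ℝ^h`, so pushing forward a pair
changes only its base point. -/
theorem isTranslationInvariant_iff
    {D : Π p : M × EuclideanSpace ℝ (Fin h), Submodule ℝ (BigTangent (prodModel I h) p)} :
    IsTranslationInvariant I D ↔ ∀ (s : EuclideanSpace ℝ (Fin h)) (p : M × EuclideanSpace ℝ (Fin h))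
      (v : E × EuclideanSpace ℝ (Fin h)) (β : (E × EuclideanSpace ℝ (Fin h)) →L[ℝ] ℝ),
      bigMk (prodModel I h) (translation s p) v β ∈ D (translation s p) ↔
        bigMk (prodModel I h) p v β ∈ D p := by
  refine forall_congr' fun s => forall_congr' fun p => ?_
  have hd := (hasMFDerivAt_translation I s p).mfderiv
  constructor
  · intro H v β
    refine (H (bigMk _ _ v β)).trans ?_
    rw [hd]
    constructor
    · rintro ⟨a, ha, h1, h2⟩
      have : a = bigMk (prodModel I h) p v β := Prod.ext h1 h2.symm
      rwa [this] at ha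
    · intro hb
      exact ⟨_, hb, rfl, rfl⟩
  · intro H b
    refine (H b.1 b.2).trans ?_
    rw [hd]
    constructor
    · intro hb
      exact ⟨_, hb, rfl, rfl⟩
    · rintro ⟨a, ha, h1, h2⟩
      have : a = bigMk (prodModel I h) p b.1 b.2 := Prod.ext h1 h2.symm
      rwa [this] at ha

theorem isTranslationInvariant_extend (L : Π x : M, Submodule ℝ (StableBigTangent I h x)) :
    IsTranslationInvariant I (extend I L) := by
  rw [isTranslationInvariant_iff]
  intro s p v β
  rw [bigMk_mem_extend_iff, bigMk_mem_extend_iff]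
  rfl

theorem extend_restrictZero
    {D : Π p : M × EuclideanSpace ℝ (Fin h), Submodule ℝ (BigTangent (prodModel I h) p)}
    (hD : IsTranslationInvariant I D) : extend I (restrictZero I D) = D := by
  rw [isTranslationInvariant_iff] at hD
  -- The target point is kept as a variable `q`, since `(x, t)` equals the translate `(x, 0 + t)`
  -- only propositionally while the fibres of `D` depend on the point.
  have key (p q : M × EuclideanSpace ℝ (Fin h)) (s : EuclideanSpace ℝ (Fin h))
      (hq : q = translation s p) (v : E × EuclideanSpace ℝ (Fin h))
      (β : (E × EuclideanSpace ℝ (Fin h)) →L[ℝ] ℝ) :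
      bigMk (prodModel I h) q v β ∈ D q ↔ bigMk (prodModel I h) p v β ∈ D p := by
    subst hq
    exact hD s p v β
  have key₀ (p : M × EuclideanSpace ℝ (Fin h)) (v : E × EuclideanSpace ℝ (Fin h))
      (β : (E × EuclideanSpace ℝ (Fin h)) →L[ℝ] ℝ) :
      unliftAt I p v β ∈ restrictZero I D p.1 ↔ bigMk (prodModel I h) (p.1, 0) v β ∈ D (p.1, 0) := by
    rw [← liftAt_unliftAt I (p.1, 0)]
    rfl
  funext p
  ext b
  refine (bigMk_mem_extend_iff I _ p b.1 b.2).trans ?_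
  refine Iff.trans ?_ (key (p.1, 0) p p.2 (by simp [translation]) b.1 b.2).symm
  exact key₀ p b.1 b.2

theorem isMaximalIsotropic_extend_iff (L : Π x : M, Submodule ℝ (StableBigTangent I h x))
    (p : M × EuclideanSpace ℝ (Fin h)) :
    IsMaximalIsotropic (bigMetric (prodModel I h) p) (extend I L p) ↔
      IsMaximalIsotropic (stableMetric I h p.1) (L p.1) :=
  isMaximalIsotropic_map_iff (liftEquiv I p) (bigMetric_liftAt I p) (L p.1)

variable [I.Boundaryless] [IsManifold I ∞ M]

theorem isSmoothSubbundle_extend {L : Π x : M, Submodule ℝ (StableBigTangent I h x)}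
    (hL : IsSmoothSubbundle (SmoothStableSectionOn I h) L) :
    IsSmoothSubbundle (SmoothBigSectionOn (prodModel I h)) (extend I L) := by
  intro p
  obtain ⟨U, hU, hp, r, e, he, hfr⟩ := hL p.1
  refine ⟨Prod.fst ⁻¹' U, hU.preimage continuous_fst, hp, r, fun i => liftSection I (e i),
    fun i => (he i).liftSection I hU, fun q hq => ?_⟩
  obtain ⟨h1, h2⟩ := hfr q.1 hq
  refine ⟨h1.map' (liftAt I q) (LinearMap.ker_eq_bot.2 (liftAt_injective I q)), ?_⟩
  have h3 : extend I L q = (L q.1).map (liftAt I q) := rfl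
  rw [h3, ← h2, Submodule.map_span, ← Set.range_comp]
  rfl

theorem isSmoothSubbundle_restrictZero
    {D : Π p : M × EuclideanSpace ℝ (Fin h), Submodule ℝ (BigTangent (prodModel I h) p)}
    (hD : IsSmoothSubbundle (SmoothBigSectionOn (prodModel I h)) D) :
    IsSmoothSubbundle (SmoothStableSectionOn I h) (restrictZero I D) := by
  intro x
  obtain ⟨U, hU, hp, r, e, he, hfr⟩ := hD (x, 0)
  refine ⟨(fun x => (x, 0)) ⁻¹' U, hU.preimage (by fun_prop), hp, r,
    fun i => restrictSection I (e i), fun i => (he i).restrictSection I hU, fun y hy => ?_⟩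
  obtain ⟨h1, h2⟩ := hfr (y, 0) hy
  have h3 : (fun i => e i (y, 0)) = liftAt I (y, 0) ∘ fun i => restrictSection I (e i) y :=
    funext fun i => (liftAt_restrictSection I (e i) y).symm
  rw [h3] at h1 h2
  refine ⟨h1.of_comp, ?_⟩
  have h4 : restrictZero I D y = (D (y, 0)).comap (liftAt I (y, 0)) := rfl
  rw [h4, ← h2, Set.range_comp, ← Submodule.map_span,
    Submodule.comap_map_eq_of_injective (liftAt_injective I (y, 0))]

theorem IsStableAlmostDirac.extend {L : Π x : M, Submodule ℝ (StableBigTangent I h x)}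
    (hL : IsStableAlmostDirac I h L) : IsAlmostDirac (prodModel I h) (extend I L) :=
  ⟨isSmoothSubbundle_extend I hL.smooth,
    fun p => (isMaximalIsotropic_extend_iff I L p).2 (hL.maximal_isotropic p.1)⟩

theorem IsAlmostDirac.restrictZero
    {D : Π p : M × EuclideanSpace ℝ (Fin h), Submodule ℝ (BigTangent (prodModel I h) p)}
    (hD : IsAlmostDirac (prodModel I h) D) (hinv : IsTranslationInvariant I D) :
    IsStableAlmostDirac I h (restrictZero I D) := by
  refine ⟨isSmoothSubbundle_restrictZero I hD.smooth, fun x => ?_⟩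
  have h1 := isMaximalIsotropic_extend_iff I (StableDirac.restrictZero I D) (x, 0)
  -- Invariance identifies `D` with an extended family, so maximality transfers through the isometry
  -- `(*)` over `t = 0`.
  rw [extend_restrictZero I hinv] at h1
  exact h1.1 (hD.maximal_isotropic (x, 0))

theorem courantBracket_liftSection (Φ : Π x : M, TangentSpace I x [⋀^Fin 3]→L[ℝ] ℝ)
    (Ψ : Fin h → Π x : M, TangentSpace I x [⋀^Fin 2]→L[ℝ] ℝ)
    {s₁ s₂ : Π x : M, StableBigTangent I h x}
    (hs₁ : SmoothStableSectionOn I h Set.univ s₁) (hs₂ : SmoothStableSectionOn I h Set.univ s₂) :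
    courantBracket (prodModel I h) (twistForm I Φ Ψ) (liftSection I s₁) (liftSection I s₂)
      = liftSection I (stableBracket I Φ Ψ s₁ s₂) := by
  funext p
  rw [smoothStableSectionOn_iff I isOpen_univ] at hs₁ hs₂
  obtain ⟨⟨hX₁, hα₁⟩, hu₁, hv₁⟩ := hs₁ p.1 trivial
  obtain ⟨⟨hX₂, hα₂⟩, hu₂, hv₂⟩ := hs₂ p.1 trivial
  have h1 := courantBracket_lift I Φ Ψ hX₁ hX₂ hu₁ hu₂ hα₁ hα₂ hv₁ hv₂
  have e₁ : liftSection I s₁ = _ := funext (liftSection_apply I s₁)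
  have e₂ : liftSection I s₂ = _ := funext (liftSection_apply I s₂)
  rw [e₁, e₂]
  exact h1

end Correspondence

section Integrability

variable {E : Type*} [NormedAddCommGroup E] [NormedSpace ℝ E]
  {H : Type*} [TopologicalSpace H] (I : ModelWithCorners ℝ E H)
  {M : Type*} [TopologicalSpace M] [ChartedSpace H M] {h : ℕ}

/-! ### Global sections through a given vector -/

section Bump

variable [I.Boundaryless] [IsManifold I ∞ M] {r : ℕ} {U : Set M} {ρ : M → ℝ}

/-- On `U` every factor is smooth; off `U` the point lies outside the closed support of `ρ`, so the
sum vanishes nearby whatever the `f i` are there. -/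
theorem contDiffAt_bump_sum {F : Type*} [NormedAddCommGroup F] [NormedSpace ℝ F]
    (hρ : ContMDiff I 𝓘(ℝ) ∞ ρ) (hsupp : tsupport ρ ⊆ U) (c : Fin r → ℝ) {x : M}
    {f : Fin r → E → F} (hf : x ∈ U → ∀ i, ContDiffAt ℝ ∞ (f i) (extChartAt I x x)) :
    ContDiffAt ℝ ∞ (fun y => ∑ i, (ρ ((extChartAt I x).symm y) * c i) • f i y)
      (extChartAt I x x) := by
  by_cases hx : x ∈ U
  · have h1 := (contMDiffAt_iff_contDiffAt_chart I).1 (hρ x)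
    exact ContDiffAt.sum fun i _ => (h1.mul contDiffAt_const).smul (hf hx i)
  · have h1 : ρ =ᶠ[nhds x] 0 := notMem_tsupport_iff_eventuallyEq.1 fun h => hx (hsupp h)
    have h2 : Filter.Tendsto (extChartAt I x).symm (nhds (extChartAt I x x)) (nhds x) := by
      have := continuousAt_extChartAt_symm (I := I) x
      rwa [ContinuousAt, extChartAt_to_inv] at this
    refine (contDiffAt_const (c := (0 : F))).congr_of_eventuallyEq ?_
    filter_upwards [h2.eventually h1] with y hy
    have hy' : ρ ((extChartAt I x).symm y) = 0 := hy
    simp only [hy', zero_mul, zero_smul, Finset.sum_const_zero]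

omit [I.Boundaryless] [IsManifold I ∞ M] in
theorem chartVector_bump_sum (c : Fin r → ℝ) (X : Fin r → M → E) (x : M) :
    chartVector I (fun y => ∑ i, (ρ y * c i) • X i y) x =
      fun y => ∑ i, (ρ ((extChartAt I x).symm y) * c i) • chartVector I (X i) x y := by
  funext y
  simp only [chartVector_apply, map_sum, map_smul]

omit [I.Boundaryless] [IsManifold I ∞ M] in
theorem chartCovector_bump_sum (c : Fin r → ℝ) (α : Fin r → M → E →L[ℝ] ℝ) (x : M) :
    chartCovector I (fun y => ∑ i, (ρ y * c i) • α i y) x =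
      fun y => ∑ i, (ρ ((extChartAt I x).symm y) * c i) • chartCovector I (α i) x y := by
  funext y
  ext v
  simp only [chartCovector_apply, ContinuousLinearMap.comp_apply, sum_apply, smul_apply]

theorem smoothStableSection_bump_sum (hU : IsOpen U)
    (hρ : ContMDiff I 𝓘(ℝ) ∞ ρ) (hsupp : tsupport ρ ⊆ U) (c : Fin r → ℝ)
    {X : Fin r → M → E} {u v : Fin r → M → EuclideanSpace ℝ (Fin h)} {α : Fin r → M → E →L[ℝ] ℝ}
    (hs : ∀ i, SmoothStableSectionOn I h U
      (fun y => stableMk I y (X i y) (u i y) (α i y) (v i y))) :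
    SmoothStableSectionOn I h Set.univ (fun y => stableMk I y (∑ i, (ρ y * c i) • X i y)
      (∑ i, (ρ y * c i) • u i y) (∑ i, (ρ y * c i) • α i y) (∑ i, (ρ y * c i) • v i y)) := by
  simp only [smoothStableSectionOn_iff I hU] at hs
  rw [smoothStableSectionOn_iff I isOpen_univ]
  intro x _
  refine ⟨⟨?_, ?_⟩, ?_, ?_⟩
  · have h1 := contDiffAt_bump_sum I hρ hsupp c (x := x) (f := fun i => chartVector I (X i) x)
      fun hx i => (hs i x hx).1.1
    rw [← chartVector_bump_sum] at h1
    exact h1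
  · have h1 := contDiffAt_bump_sum I hρ hsupp c (x := x) (f := fun i => chartCovector I (α i) x)
      fun hx i => (hs i x hx).1.2
    rw [← chartCovector_bump_sum] at h1
    exact h1
  · refine (contMDiffAt_iff_contDiffAt_chart I).2 (contDiffAt_bump_sum I hρ hsupp c (x := x)
      (f := fun i => u i ∘ (extChartAt I x).symm) fun hx i => ?_)
    exact (contMDiffAt_iff_contDiffAt_chart I).1 (hs i x hx).2.1
  · refine (contMDiffAt_iff_contDiffAt_chart I).2 (contDiffAt_bump_sum I hρ hsupp c (x := x)
      (f := fun i => v i ∘ (extChartAt I x).symm) fun hx i => ?_)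
    exact (contMDiffAt_iff_contDiffAt_chart I).1 (hs i x hx).2.2

omit [I.Boundaryless] [IsManifold I ∞ M] in
theorem stableMk_sum (x : M) (c : Fin r → ℝ) (a : Fin r → StableBigTangent I h x)
    (X : Fin r → E) (u v : Fin r → EuclideanSpace ℝ (Fin h)) (α : Fin r → E →L[ℝ] ℝ)
    (ha : ∀ i, a i = stableMk I x (X i) (u i) (α i) (v i)) :
    stableMk I x (∑ i, c i • X i) (∑ i, c i • u i) (∑ i, c i • α i) (∑ i, c i • v i)
      = ∑ i, c i • a i := by
  obtain rfl : a = fun i => stableMk I x (X i) (u i) (α i) (v i) := funext ha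
  have : ∑ i, c i • (((X i, u i), (α i, v i)) :
      (E × EuclideanSpace ℝ (Fin h)) × ((E →L[ℝ] ℝ) × EuclideanSpace ℝ (Fin h)))
      = ((∑ i, c i • X i, ∑ i, c i • u i), (∑ i, c i • α i, ∑ i, c i • v i)) := by
    simp only [Prod.smul_mk, Prod.ext_iff, Prod.fst_sum, Prod.snd_sum, and_self]
  exact this.symm

/-- Write `a` in a local frame with constant coefficients and multiply by a bump function equal to
`1` at `x` and supported in the domain of the frame. -/
theorem exists_smooth_section_eq [FiniteDimensional ℝ E] [T2Space M]
    {L : Π x : M, Submodule ℝ (StableBigTangent I h x)}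
    (hL : IsSmoothSubbundle (SmoothStableSectionOn I h) L) {x : M} {a : StableBigTangent I h x}
    (ha : a ∈ L x) :
    ∃ s : Π y : M, StableBigTangent I h y,
      SmoothStableSectionOn I h Set.univ s ∧ (∀ y, s y ∈ L y) ∧ s x = a := by
  obtain ⟨U, hU, hx, r, e, he, hfr⟩ := hL x
  rw [← (hfr x hx).2] at ha
  obtain ⟨c, rfl⟩ := (Submodule.mem_span_range_iff_exists_fun ℝ).1 ha
  obtain ⟨f, -, hf⟩ := (SmoothBumpFunction.nhds_basis_tsupport (I := I) x).mem_iff.1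
    (hU.mem_nhds hx)
  have hsum (y : M) := stableMk_sum I y (fun i => f y * c i) (fun i => e i y)
    (fun i => (e i y).1.1) (fun i => (e i y).1.2) (fun i => (e i y).2.2) (fun i => (e i y).2.1)
    fun i => rfl
  refine ⟨_, smoothStableSection_bump_sum I hU f.contMDiff hf c
    (X := fun i y => (e i y).1.1) (u := fun i y => (e i y).1.2) (α := fun i y => (e i y).2.1)
    (v := fun i y => (e i y).2.2) he, fun y => ?_, ?_⟩
  · refine (hsum y).symm ▸ ?_
    -- Outside `U` the frame fields need not lie in `L`, but the bump function vanishes there.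
    by_cases hy : y ∈ U
    · refine Submodule.sum_mem _ fun i _ => Submodule.smul_mem _ _ ?_
      rw [← (hfr y hy).2]
      exact Submodule.subset_span ⟨i, rfl⟩
    · have h0 : f y = 0 := image_eq_zero_of_notMem_tsupport fun h => hy (hf h)
      simp only [h0, zero_mul, zero_smul, Finset.sum_const_zero]
      exact Submodule.zero_mem _
  · refine (hsum x).trans ?_
    simp only [f.eq_one, one_mul]

end Bump

/-! ### Integrability -/

theorem IsMaximalIsotropic.mem_of_bigMetric_eq_zero [FiniteDimensional ℝ E] {x : M}
    {W : Submodule ℝ (BigTangent I x)} (hW : IsMaximalIsotropic (bigMetric I x) W)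
    {w : BigTangent I x} (hw : ∀ a ∈ W, bigMetric I x w a = 0) : w ∈ W :=
  IsMaximalIsotropic.mem_of_neutralForm_eq_zero (E := E) hW hw

variable [I.Boundaryless] [IsManifold I ∞ M]

theorem bigMetric_courantBracket_cyclic (Θ : Π x : M, TangentSpace I x [⋀^Fin 3]→L[ℝ] ℝ)
    {s₁ s₂ s₃ : Π x : M, BigTangent I x} (h₁ : SmoothBigSectionOn I Set.univ s₁)
    (h₂ : SmoothBigSectionOn I Set.univ s₂) (h₃ : SmoothBigSectionOn I Set.univ s₃)
    (h₁₂ : ∀ y, bigMetric I y (s₁ y) (s₂ y) = 0) (h₂₃ : ∀ y, bigMetric I y (s₂ y) (s₃ y) = 0)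
    (h₁₃ : ∀ y, bigMetric I y (s₁ y) (s₃ y) = 0) (x : M) :
    bigMetric I x (courantBracket I Θ s₁ s₂ x) (s₃ x) =
      bigMetric I x (courantBracket I Θ s₂ s₃ x) (s₁ x) := by
  rw [smoothBigSectionOn_iff I isOpen_univ] at h₁ h₂ h₃
  have hpos : (0 : ℝ) < 1 / 2 := by norm_num
  exact bigMetric_courantBracket_rotate I Θ (h₁ x trivial).1 (h₁ x trivial).2 (h₂ x trivial).1
    (h₂ x trivial).2 (h₃ x trivial).1 (h₃ x trivial).2
    (fun y => (mul_eq_zero.1 (h₁₂ y)).resolve_left hpos.ne')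
    (fun y => (mul_eq_zero.1 (h₂₃ y)).resolve_left hpos.ne')
    (fun y => (mul_eq_zero.1 (h₁₃ y)).resolve_left hpos.ne')

omit [I.Boundaryless] [IsManifold I ∞ M] in
theorem liftSection_mem_extend {L : Π x : M, Submodule ℝ (StableBigTangent I h x)}
    {s : Π x : M, StableBigTangent I h x} (hs : ∀ x, s x ∈ L x)
    (p : M × EuclideanSpace ℝ (Fin h)) : liftSection I s p ∈ extend I L p :=
  Submodule.mem_map_of_mem (hs p.1)

theorem isStableIntegrable_iff [FiniteDimensional ℝ E] [T2Space M]
    (Φ : Π x : M, TangentSpace I x [⋀^Fin 3]→L[ℝ] ℝ)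
    (Ψ : Fin h → Π x : M, TangentSpace I x [⋀^Fin 2]→L[ℝ] ℝ)
    {L : Π x : M, Submodule ℝ (StableBigTangent I h x)} (hL : IsStableAlmostDirac I h L) :
    IsStableIntegrable I Φ Ψ L ↔
      IsIntegrable (prodModel I h) (twistForm I Φ Ψ) (extend I L) := by
  have hlift {s : Π x : M, StableBigTangent I h x} (hs : SmoothStableSectionOn I h Set.univ s) :
      SmoothBigSectionOn (prodModel I h) Set.univ (liftSection I s) :=
    hs.liftSection I isOpen_univ
  constructor
  · intro hint s₁ s₂ h₁ h₂ hm₁ hm₂ p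
    have hmax (q : M × EuclideanSpace ℝ (Fin h)) := (hL.extend I).maximal_isotropic q
    refine (hmax p).mem_of_bigMetric_eq_zero _ ?_
    rintro _ ⟨a₃, ha₃, rfl⟩
    obtain ⟨a₁, ha₁, he₁⟩ := hm₁ p
    obtain ⟨a₂, ha₂, he₂⟩ := hm₂ p
    -- The lifts of `σ₁`, `σ₂`, `σ₃` are invariant sections of `L̃` with the prescribed values at
    -- the single point `p`.
    obtain ⟨σ₁, hσ₁, hσm₁, rfl⟩ := exists_smooth_section_eq I hL.smooth ha₁
    obtain ⟨σ₂, hσ₂, hσm₂, rfl⟩ := exists_smooth_section_eq I hL.smooth ha₂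
    obtain ⟨σ₃, hσ₃, hσm₃, rfl⟩ := exists_smooth_section_eq I hL.smooth ha₃
    have hl₁ := liftSection_mem_extend I hσm₁
    have hl₂ := liftSection_mem_extend I hσm₂
    have hl₃ := liftSection_mem_extend I hσm₃
    have iso {s t : Π q : M × EuclideanSpace ℝ (Fin h), BigTangent (prodModel I h) q}
        (hs : ∀ q, s q ∈ extend I L q) (ht : ∀ q, t q ∈ extend I L q) (q) :
        bigMetric (prodModel I h) q (s q) (t q) = 0 := (hmax q).1 _ (hs q) _ (ht q)
    have h3 : liftAt I p (σ₃ p.1) = liftSection I σ₃ p := rfl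
    have h1 : s₁ p = liftSection I σ₁ p := he₁.symm
    have h2 : s₂ p = liftSection I σ₂ p := he₂.symm
    -- Writing `σ̃ᵢ` for the lifts, `G([s₁, s₂], σ̃₃) = G([s₂, σ̃₃], s₁) = G([s₂, σ̃₃], σ̃₁) =
    -- G([σ̃₃, σ̃₁], s₂) = G([σ̃₃, σ̃₁], σ̃₂)`: each rotation moves a section to the
    -- undifferentiated slot, where only its value at `p` matters. The last bracket is the lift of a
    -- stable bracket, which lies in `L`.
    rw [h3, bigMetric_courantBracket_cyclic _ _ h₁ h₂ (hlift hσ₃) (iso hm₁ hm₂) (iso hm₂ hl₃)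
      (iso hm₁ hl₃), h1, bigMetric_courantBracket_cyclic _ _ h₂ (hlift hσ₃) (hlift hσ₁)
      (iso hm₂ hl₃) (iso hl₃ hl₁) (iso hm₂ hl₁), h2,
      courantBracket_liftSection I Φ Ψ hσ₃ hσ₁]
    exact iso (liftSection_mem_extend I (hint _ _ hσ₃ hσ₁ hσm₃ hσm₁)) hl₂ p
  · intro hint s₁ s₂ h₁ h₂ hm₁ hm₂ x
    have h3 := hint _ _ (hlift h₁) (hlift h₂) (liftSection_mem_extend I hm₁)
      (liftSection_mem_extend I hm₂) (x, 0)
    rw [courantBracket_liftSection I Φ Ψ h₁ h₂] at h3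
    exact (liftAt_injective I (x, 0)).mem_set_image.1 h3

end Integrability

end StableDirac

theorem proposition2p1
    {E : Type*} [NormedAddCommGroup E] [NormedSpace ℝ E] [FiniteDimensional ℝ E]
    {H : Type*} [TopologicalSpace H] (I : ModelWithCorners ℝ E H) [I.Boundaryless]
    (M : Type*) [TopologicalSpace M] [T2Space M] [ChartedSpace H M] [IsManifold I ∞ M]
    (h : ℕ) :
    -- the invariant sections defined by stable sections: the stable bracket is the restriction
    -- of the Courant bracket of `M × ℝ^h` with the twist form
    (∀ (Φ : Π x : M, TangentSpace I x [⋀^Fin 3]→L[ℝ] ℝ)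
        (Ψ : Fin h → Π x : M, TangentSpace I x [⋀^Fin 2]→L[ℝ] ℝ),
        IsClosedForm I Φ → (∀ a, IsClosedForm I (Ψ a)) →
        ∀ s₁ s₂ : Π x : M, StableBigTangent I h x,
          SmoothStableSectionOn I h Set.univ s₁ → SmoothStableSectionOn I h Set.univ s₂ →
          courantBracket (prodModel I h) (twistForm I Φ Ψ) (liftSection I s₁) (liftSection I s₂)
            = liftSection I (stableBracket I Φ Ψ s₁ s₂)) ∧
    -- `L ↦ L̃` and `L̃ ↦ L̃|_{t = 0}` are mutually inverse bijections
    Set.BijOn (extend I) {L | IsStableAlmostDirac (M := M) I h L}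
      {D | IsAlmostDirac (prodModel I h) D ∧ IsTranslationInvariant I D} ∧
    Set.InvOn (restrictZero I) (extend I) {L | IsStableAlmostDirac (M := M) I h L}
      {D | IsAlmostDirac (prodModel I h) D ∧ IsTranslationInvariant I D} ∧
    -- `L` and `L̃` are simultaneously integrable or not
    (∀ (Φ : Π x : M, TangentSpace I x [⋀^Fin 3]→L[ℝ] ℝ)
        (Ψ : Fin h → Π x : M, TangentSpace I x [⋀^Fin 2]→L[ℝ] ℝ),
        IsClosedForm I Φ → (∀ a, IsClosedForm I (Ψ a)) →
        ∀ L : Π x : M, Submodule ℝ (StableBigTangent I h x), IsStableAlmostDirac I h L →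
          (IsStableIntegrable I Φ Ψ L ↔
            IsIntegrable (prodModel I h) (twistForm I Φ Ψ) (extend I L))) := by
  refine ⟨fun Φ Ψ _ _ s₁ s₂ h₁ h₂ => courantBracket_liftSection I Φ Ψ h₁ h₂, ?_, ?_,
    fun Φ Ψ _ _ L hL => isStableIntegrable_iff I Φ Ψ hL⟩
  · refine ⟨fun L hL => ⟨hL.extend I, isTranslationInvariant_extend I L⟩, ?_, ?_⟩
    · intro L _ L' _ hLL'
      rw [← restrictZero_extend I L, hLL', restrictZero_extend]
    · rintro D ⟨hD, hinv⟩
      exact ⟨restrictZero I D, hD.restrictZero I hinv, extend_restrictZero I hinv⟩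
  · exact ⟨fun L _ => restrictZero_extend I L, fun D hD => extend_restrictZero I hD.2⟩
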